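/- Let $E=(E^0,E^1,r,s)$ be an arbitrary directed graph (any numbers of vertices and edges), let $K$ be a field, and let $L=L_K(E)$ be the Leavitt path algebra: the (not necessarily unital) $K$-algebra generated by pairwise orthogonal idempotents $v\in E^0$ and elements $e,e^*$ $(e\in E^1)$ with the relations $s(e)e=e=e\,r(e)$, $r(e)e^*=e^*=e^*s(e)$, $e^*e=r(e)$, $e^*f=0$ for $e\ne f$ in $E^1$, and $v=\sum_{s(e)=v}ee^*$ for every vertex $v$ with $0<|s^{-1}(v)|<\infty$. A left $L$-module $M$ is called simple if $LM\neq 0$ and its only submodules are $0$ and $M$, and $L$ is called (left) semi-artinian if every nonzero left $L$-module $M$ with $LM=M$ has a simple submodule. A (not necessarily unital) ring $S$ is called simple if $S^2\ne0$ and its only two-sided ideals are $0$ and $S$. Suppose that $L$ is semi-artinian and has only finitely many two-sided ideals. Then $L$ has only finitely many isomorphism classes of simple left modules. More precisely, $L$ has a finite maximal chain of two-sided ideals $$0=S_0<S_1<\cdots<S_n=L ,$$ and for every such chain (that is, every finite chain from $0$ to $L$ with no two-sided ideal of $L$ strictly between $S_i$ and $S_{i+1}$ for any $i<n$) each factor $S_{i+1}/S_i$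 is a simple ring, and the number of isomorphism classes of simple left $L$-modules is exactly $n$. -/

import Mathlib

universe uV uE uK

/-! ## Directed graphs and Leavitt path algebras -/

/-- A directed graph `E = (E⁰, E¹, r, s)`, with no restriction on the number of vertices or edges. -/
structure DirectedGraph where
  /-- The set `E⁰` of vertices. -/
  vertex : Type uV
  /-- The set `E¹` of edges. -/
  edge : Type uE
  /-- The source map. -/
  s : edge → vertex
  /-- The range map. -/
  r : edge → vertex

namespace DirectedGraph

variable (E : DirectedGraph.{uV, uE}) (K : Type uK) [Field K]

/-- The generators of a Leavitt path algebra: vertices `v`, edges `e` and ghost edges `e*`. -/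
inductive Generator where
  | vert (v : E.vertex)
  | real (e : E.edge)
  | ghost (e : E.edge)

open FreeAlgebra Generator in
/-- The defining relations of the Leavitt path algebra.  A vertex `v` is regular if `s⁻¹(v)` is
finite and nonempty; only such vertices carry the relation `ck2`. -/
inductive LeavittRel : FreeAlgebra K E.Generator → FreeAlgebra K E.Generator → Prop
  | vert_idem (v : E.vertex) :
      LeavittRel (ι K (vert v) * ι K (vert v)) (ι K (vert v))
  | vert_orth (v w : E.vertex) (h : v ≠ w) :
      LeavittRel (ι K (vert v) * ι K (vert w)) 0
  | source_real (e : E.edge) :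
      LeavittRel (ι K (vert (E.s e)) * ι K (real e)) (ι K (real e))
  | real_range (e : E.edge) :
      LeavittRel (ι K (real e) * ι K (vert (E.r e))) (ι K (real e))
  | range_ghost (e : E.edge) :
      LeavittRel (ι K (vert (E.r e)) * ι K (ghost e)) (ι K (ghost e))
  | ghost_source (e : E.edge) :
      LeavittRel (ι K (ghost e) * ι K (vert (E.s e))) (ι K (ghost e))
  | ck1_same (e : E.edge) :
      LeavittRel (ι K (ghost e) * ι K (real e)) (ι K (vert (E.r e)))
  | ck1_ne (e f : E.edge) (h : e ≠ f) :
      LeavittRel (ι K (ghost e) * ι K (real f)) 0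
  | ck2 (v : E.vertex) (hfin : {e : E.edge | E.s e = v}.Finite)
      (hne : {e : E.edge | E.s e = v}.Nonempty) :
      LeavittRel (ι K (vert v)) (∑ e ∈ hfin.toFinset, ι K (real e) * ι K (ghost e))

/-- The unital `K`-algebra presented by the generators and relations of the Leavitt path algebra.
Since no relation involves `1`, this is `L_K(E)` with a unit adjoined. -/
abbrev UnitalLeavittAlgebra : Type (max uV uE uK) := RingQuot (LeavittRel E K)

/-- The image of a generator in the presented algebra. -/
def leavittGen (g : E.Generator) : UnitalLeavittAlgebra E K :=
  RingQuot.mkAlgHom K (LeavittRel E K) (FreeAlgebra.ι K g)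

/-- The non-unital subalgebra generated by the vertices, edges and ghost edges. -/
abbrev leavittSubalgebra : NonUnitalSubalgebra K (UnitalLeavittAlgebra E K) :=
  NonUnitalAlgebra.adjoin K (Set.range (leavittGen E K))

/-- The Leavitt path algebra `L_K(E)`, as a non-unital `K`-algebra (it has an identity only when
`E` has finitely many vertices): the non-unital subalgebra generated by the vertices, edges and
ghost edges inside the unital algebra with the same presentation.  This is the non-unital
`K`-algebra with the given presentation: a non-unital algebra `B` with elements satisfying
the relations receives a unital homomorphism from `UnitalLeavittAlgebra E K` to the unitization
of `B`, which restricts to a homomorphism from `L_K(E)` to `B`. -/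
def LeavittPathAlgebra : Type (max uV uE uK) := leavittSubalgebra E K

namespace LeavittPathAlgebra

instance instNonUnitalRing : NonUnitalRing (E.LeavittPathAlgebra K) :=
  inferInstanceAs (NonUnitalRing (leavittSubalgebra E K))

instance instModule : Module K (E.LeavittPathAlgebra K) :=
  inferInstanceAs (Module K (leavittSubalgebra E K))

instance instIsScalarTower :
    IsScalarTower K (E.LeavittPathAlgebra K) (E.LeavittPathAlgebra K) :=
  inferInstanceAs (IsScalarTower K (leavittSubalgebra E K) (leavittSubalgebra E K))

instance instSMulCommClass :
    SMulCommClass K (E.LeavittPathAlgebra K) (E.LeavittPathAlgebra K) :=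
  inferInstanceAs (SMulCommClass K (leavittSubalgebra E K) (leavittSubalgebra E K))

end LeavittPathAlgebra

end DirectedGraph

/-! ## Modules over rings without identity

A left module over a (possibly non-unital) ring `R` is an abelian group with a biadditive
associative action of `R`.  This is the same thing as a unital module over the ring
`ℤ ⊕ R` obtained from `R` by adjoining an identity; submodules and module isomorphisms are the same
on both sides. -/

section NonUnitalModules

universe u

variable (R : Type u) [NonUnitalRing R]

/-- The ring `ℤ ⊕ R` obtained from `R` by adjoining an identity. -/
def WithIdentity : Type u := Unitization ℤ R

instance WithIdentity.instRing : Ring (WithIdentity R) := inferInstanceAs (Ring (Unitization ℤ R))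

variable {R} in
/-- The inclusion of `R` in `ℤ ⊕ R`. -/
def WithIdentity.incl : R →ₙ+* WithIdentity R where
  toFun a := (Unitization.inr a : Unitization ℤ R)
  map_mul' a b := Unitization.inr_mul ℤ a b
  map_zero' := Unitization.inr_zero ℤ
  map_add' a b := Unitization.inr_add ℤ a b

open WithIdentity in
/-- A left `R`-module `M` is simple if `RM ≠ 0` and `M` has exactly two submodules, `0` and `M`. -/
def IsSimpleLeftModule (M : Type*) [AddCommGroup M] [Module (WithIdentity R) M] : Prop :=
  IsSimpleModule (WithIdentity R) M ∧ ∃ (a : R) (m : M), incl a • m ≠ 0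

open WithIdentity in
/-- A left `R`-module `M` is unitary if `RM = M`, where `RM` is the group of finite sums of
elements `a • m`. -/
def IsUnitaryLeftModule (M : Type*) [AddCommGroup M] [Module (WithIdentity R) M] : Prop :=
  AddSubgroup.closure {x : M | ∃ (a : R) (m : M), x = incl a • m} = ⊤

/-- A ring is (left) semi-artinian if every nonzero unitary left module has nonzero socle, that is,
contains a simple submodule. -/
def IsSemiArtinianRing : Prop :=
  ∀ (M : Type u) [AddCommGroup M] [Module (WithIdentity R) M], Nontrivial M →
    IsUnitaryLeftModule R M → ∃ S : Submodule (WithIdentity R) M, IsSimpleLeftModule R S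

/-- The simple left `R`-modules.  A simple module is generated by one element, so
every simple module is isomorphic to one in the universe of `R`. -/
structure SimpleLeftModule : Type (u + 1) where
  carrier : Type u
  [group : AddCommGroup carrier]
  [module : Module (WithIdentity R) carrier]
  simple : IsSimpleLeftModule R carrier

attribute [instance] SimpleLeftModule.group SimpleLeftModule.module

/-- Isomorphism of simple left modules. -/
instance SimpleLeftModule.setoid : Setoid (SimpleLeftModule R) where
  r M N := Nonempty (M.carrier ≃ₗ[WithIdentity R] N.carrier)
  iseqv :=
    ⟨fun _ => ⟨LinearEquiv.refl _ _⟩, fun ⟨f⟩ => ⟨f.symm⟩, fun ⟨f⟩ ⟨g⟩ => ⟨f.trans g⟩⟩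

/-- The isomorphism classes of simple left `R`-modules. -/
def SimpleModuleClasses : Type (u + 1) := Quotient (SimpleLeftModule.setoid R)

end NonUnitalModules

/-! ## Chains of two-sided ideals -/

section IdealChains

variable {R : Type*} [NonUnitalRing R]

/-- A two-sided ideal, viewed as a ring without identity. -/
def TwoSidedIdeal.asSubring (J : TwoSidedIdeal R) : NonUnitalSubring R where
  carrier := {x | x ∈ J}
  add_mem' := J.add_mem
  zero_mem' := J.zero_mem
  neg_mem' := J.neg_mem
  mul_mem' := fun {a _} _ hb => J.mul_mem_left a _ hb

/-- The factor ring `J / I`, for two-sided ideals `I ≤ J` of `R`. -/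
abbrev TwoSidedIdeal.FactorRing (I J : TwoSidedIdeal R) : Type _ :=
  (I.comap (NonUnitalSubringClass.subtype J.asSubring)).ringCon.Quotient

/-- A ring `S` without identity is simple if `S² ≠ 0` and it has exactly two two-sided ideals. -/
def IsSimpleNonUnitalRing (S : Type*) [NonUnitalRing S] : Prop :=
  IsSimpleRing S ∧ ∃ a b : S, a * b ≠ 0

/-- `0 = S₀ < S₁ < ⋯ < Sₙ = R` is a maximal chain of two-sided ideals of `R`: no two-sided ideal
lies strictly between `Sᵢ` and `Sᵢ₊₁`. -/
structure IsMaximalIdealChain {n : ℕ} (S : Fin (n + 1) → TwoSidedIdeal R) : Prop where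
  bot : S 0 = ⊥
  top : S (Fin.last n) = ⊤
  step : ∀ i : Fin n, S i.castSucc ⋖ S i.succ

end IdealChains

/-! Each simple module is attached to one step of a maximal chain. The ideals of the chain that
annihilate a simple module M form an initial segment containing 0 and not L, so exactly one step I <
J has IM = 0 and JM ≠ 0.

Conversely, suppose J covers I and J² ⊄ I. Local units make J/I a nonzero unitary left module, so
semi-artinianity gives a simple submodule S of J/I. The elements y of J with Jy ⊆ I form a two-sided
ideal, which must be I, so J does not kill S. If N is simple with IN = 0 and JN ≠ 0, the elements of
J killing N are those of I, so a nonzero class of x in S has xm ≠ 0 for some m in N. Right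
multiplication by m is then a nonzero map S → N, an isomorphism by Schur's lemma. Thus every step
carries exactly one class (`IsSemiArtinianRing.exists_simple`), and
`TwoSidedIdeal.isSimple_factorRing` shows that its factor ring is simple.

What remains is J² ⊄ I for all ideals I < J. If E has no closed paths, some idempotent lies in J but
not in I (`exists_idempotent_of_lt`): right multiplication by edges and by idempotents ε = v - ∑ e
e* reduces an element of J outside I to yε with y a combination of paths, and acyclicity lets the
adjoint of one path isolate its coefficient.

Closed paths are excluded by `not_isSemiArtinianRing`. A closed path of length n, repeated forever,
gives an infinite path ξ; let L act on Laurent-polynomial-valued functions on infinite paths, real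
edges contributing T and ghost edges T⁻¹. A simple submodule of the module generated by the delta
function δ at ξ would contain some rδ with r ≠ 0, hence also (T⁻ⁿ - 1)rδ. The latter would have to
generate rδ, making T⁻ⁿ - 1 invertible. -/

section NonUnitalGeneral

/-! ### Covering pairs of two-sided ideals and their factor rings. -/

variable {R : Type*} [NonUnitalRing R]

/-- Covering pairs of ideals with nonzero product: the ideal of elements of `J` annihilated by `J`
modulo `I` is `I`. -/
theorem TwoSidedIdeal.mem_of_forall_mul_mem {I J : TwoSidedIdeal R} (hIJ : I ⋖ J)
    (hsq : ∃ a ∈ J, ∃ b ∈ J, a * b ∉ I) {x : R} (hx : x ∈ J) (h : ∀ j ∈ J, j * x ∈ I) :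
    x ∈ I := by
  let T : TwoSidedIdeal R := TwoSidedIdeal.mk' {y | y ∈ J ∧ ∀ j ∈ J, j * y ∈ I}
    ⟨J.zero_mem, fun j _ => by simp⟩
    (fun hx hy => ⟨J.add_mem hx.1 hy.1, fun j hj => by
      rw [mul_add]; exact I.add_mem (hx.2 j hj) (hy.2 j hj)⟩)
    (fun hx => ⟨J.neg_mem hx.1, fun j hj => by rw [mul_neg]; exact I.neg_mem (hx.2 j hj)⟩)
    (fun {x y} hy => ⟨J.mul_mem_left _ _ hy.1, fun j hj => by
      rw [← mul_assoc]; exact hy.2 _ (J.mul_mem_right _ _ hj)⟩)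
    (fun {x y} hx => ⟨J.mul_mem_right _ _ hx.1, fun j hj => by
      rw [← mul_assoc]; exact I.mul_mem_right _ _ (hx.2 _ hj)⟩)
  have hT : ∀ y, y ∈ T ↔ y ∈ J ∧ ∀ j ∈ J, j * y ∈ I := fun y => TwoSidedIdeal.mem_mk' _ _ _ _ _ _ y
  -- T lies between I and J, so it is one of them; T = J would mean J² ⊆ I.
  rcases hIJ.eq_or_eq (c := T)
    (fun y hy => (hT y).2 ⟨hIJ.le hy, fun j _ => I.mul_mem_left _ _ hy⟩)
    (fun y hy => ((hT y).1 hy).1) with h1 | h1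
  · rw [← h1]; exact (hT x).2 ⟨hx, h⟩
  · obtain ⟨a, ha, b, hb, hab⟩ := hsq
    rw [← h1] at hb
    exact absurd (((hT b).1 hb).2 a ha) hab

/-- The elements y of J with JyJ ⊆ I form an ideal between I and J. If it were J, then J(ab) ⊆ I for
all a, b in J, and the one-sided version would put every ab in I. -/
theorem TwoSidedIdeal.mem_of_forall_mul_mul_mem {I J : TwoSidedIdeal R} (hIJ : I ⋖ J)
    (hsq : ∃ a ∈ J, ∃ b ∈ J, a * b ∉ I) {x : R} (hx : x ∈ J)
    (h : ∀ j ∈ J, ∀ k ∈ J, j * x * k ∈ I) : x ∈ I := by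
  let T : TwoSidedIdeal R := TwoSidedIdeal.mk' {y | y ∈ J ∧ ∀ j ∈ J, ∀ k ∈ J, j * y * k ∈ I}
    ⟨J.zero_mem, fun j _ k _ => by simp⟩
    (fun hx hy => ⟨J.add_mem hx.1 hy.1, fun j hj k hk => by
      rw [mul_add, add_mul]; exact I.add_mem (hx.2 j hj k hk) (hy.2 j hj k hk)⟩)
    (fun hx => ⟨J.neg_mem hx.1, fun j hj k hk => by
      rw [mul_neg, neg_mul]; exact I.neg_mem (hx.2 j hj k hk)⟩)
    (fun {x y} hy => ⟨J.mul_mem_left _ _ hy.1, fun j hj k hk => by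
      rw [← mul_assoc]; exact hy.2 _ (J.mul_mem_right _ _ hj) k hk⟩)
    (fun {x y} hx => ⟨J.mul_mem_right _ _ hx.1, fun j hj k hk => by
      rw [← mul_assoc, mul_assoc _ y]; exact hx.2 _ hj _ (J.mul_mem_left _ _ hk)⟩)
  have hT : ∀ y, y ∈ T ↔ y ∈ J ∧ ∀ j ∈ J, ∀ k ∈ J, j * y * k ∈ I :=
    fun y => TwoSidedIdeal.mem_mk' _ _ _ _ _ _ y
  rcases hIJ.eq_or_eq (c := T)
    (fun y hy => (hT y).2 ⟨hIJ.le hy, fun j _ k _ => I.mul_mem_right _ _ (I.mul_mem_left _ _ hy)⟩)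
    (fun y hy => ((hT y).1 hy).1) with h1 | h1
  · rw [← h1]; exact (hT x).2 ⟨hx, h⟩
  · exfalso
    obtain ⟨a, ha, b, hb, hab⟩ := hsq
    refine hab (TwoSidedIdeal.mem_of_forall_mul_mem hIJ ⟨a, ha, b, hb, hab⟩
      (J.mul_mem_left _ _ hb) fun j hj => ?_)
    rw [← h1] at ha
    rw [← mul_assoc]
    exact ((hT a).1 ha).2 j hj b hb

/-- A covering pair of ideals with nonzero product, in a ring with local units, has a simple factor
ring. -/
theorem TwoSidedIdeal.isSimple_factorRing (hu : ∀ x : R, ∃ e, e * x = x ∧ x * e = x)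
    {I J : TwoSidedIdeal R} (hIJ : I ⋖ J) (hsq : ∃ a ∈ J, ∃ b ∈ J, a * b ∉ I) :
    IsSimpleNonUnitalRing (TwoSidedIdeal.FactorRing I J) := by
  let C : TwoSidedIdeal J.asSubring := I.comap (NonUnitalSubringClass.subtype J.asSubring)
  let q : J.asSubring → TwoSidedIdeal.FactorRing I J := fun x => (x : C.ringCon.Quotient)
  have hq0 : ∀ x : J.asSubring, q x = 0 ↔ (x : R) ∈ I := by
    intro x
    have : q x = 0 ↔ C.ringCon x 0 := RingCon.eq C.ringCon
    rw [this, ← TwoSidedIdeal.mem_iff, TwoSidedIdeal.mem_comap]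
    rfl
  have hqs : ∀ z, ∃ x, q x = z := fun z => Quotient.inductionOn' z fun x => ⟨x, rfl⟩
  obtain ⟨a, ha, b, hb, hab⟩ := hsq
  have hmul : q ⟨a, ha⟩ * q ⟨b, hb⟩ ≠ 0 := fun h =>
    hab ((hq0 ((⟨a, ha⟩ : J.asSubring) * (⟨b, hb⟩ : J.asSubring))).1 h)
  have : Nontrivial (TwoSidedIdeal.FactorRing I J) := ⟨_, _, hmul⟩
  refine ⟨⟨{ exists_pair_ne := exists_pair_ne _, eq_bot_or_eq_top := fun A => ?_ }⟩, _, _, hmul⟩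
  by_contra hA
  push Not at hA
  obtain ⟨hA0, hA1⟩ := hA
  -- The preimage of A in J is only known to be an ideal of J. Asking for all products r * y * s
  -- gives an ideal of R, to which the covering relation applies.
  let T : TwoSidedIdeal R := TwoSidedIdeal.mk'
    {y | ∃ hy : y ∈ J, ∀ r s : R, q ⟨r * y * s, J.mul_mem_right _ _ (J.mul_mem_left _ _ hy)⟩ ∈ A}
    ⟨J.zero_mem, fun r s => by
      convert A.zero_mem
      rw [hq0]
      simp⟩
    (by
      rintro x y ⟨hx, hx'⟩ ⟨hy, hy'⟩
      refine ⟨J.add_mem hx hy, fun r s => ?_⟩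
      convert A.add_mem (hx' r s) (hy' r s) using 1
      change _ = q (_ + _)
      congr 1
      ext
      simp [mul_add, add_mul])
    (by
      rintro x ⟨hx, hx'⟩
      refine ⟨J.neg_mem hx, fun r s => ?_⟩
      convert A.neg_mem (hx' r s) using 1
      change _ = q (- _)
      congr 1
      ext
      simp)
    (by
      rintro x y ⟨hx, hx'⟩
      refine ⟨J.mul_mem_left _ _ hx, fun r s => ?_⟩
      convert hx' (r * x) s using 3
      simp only [mul_assoc])
    (by
      rintro x y ⟨hx, hx'⟩
      refine ⟨J.mul_mem_right _ _ hx, fun r s => ?_⟩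
      convert hx' r (y * s) using 3
      simp only [mul_assoc])
  have hT : ∀ y, y ∈ T ↔ ∃ hy : y ∈ J, ∀ r s : R,
      q ⟨r * y * s, J.mul_mem_right _ _ (J.mul_mem_left _ _ hy)⟩ ∈ A :=
    fun y => TwoSidedIdeal.mem_mk' _ _ _ _ _ _ y
  have hqI : ∀ x : J.asSubring, (x : R) ∈ I → q x ∈ A := fun x hx => by
    rw [(hq0 x).2 hx]; exact A.zero_mem
  rcases hIJ.eq_or_eq (c := T)
    (fun y hy => (hT y).2 ⟨hIJ.le hy, fun r s => hqI _ <|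
      I.mul_mem_right _ _ (I.mul_mem_left _ _ hy)⟩)
    (fun y hy => ((hT y).1 hy).1) with h1 | h1
  -- If T = I and x represents an element of A, then JxJ ⊆ T: in r(jxk)s the factors rj and ks are
  -- in J, whose classes A absorbs. Hence x is in I.
  · refine hA0 (eq_bot_iff.2 fun z hz => ?_)
    obtain ⟨⟨x, hx⟩, rfl⟩ := hqs z
    change x ∈ J at hx
    rw [TwoSidedIdeal.mem_bot, hq0]
    refine TwoSidedIdeal.mem_of_forall_mul_mul_mem hIJ ⟨a, ha, b, hb, hab⟩ hx fun j hj k hk => ?_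
    rw [← h1, hT]
    refine ⟨J.mul_mem_right _ _ (J.mul_mem_left _ _ hx), fun r s => ?_⟩
    have hrj : r * j ∈ J.asSubring := J.mul_mem_left _ _ hj
    have hks : k * s ∈ J.asSubring := J.mul_mem_right _ _ hk
    convert A.mul_mem_right _ (q ⟨k * s, hks⟩) (A.mul_mem_left (q ⟨r * j, hrj⟩) _ hz) using 1
    change _ = q (_ * _ * _)
    congr 1
    ext
    simp [mul_assoc]
  · refine hA1 (eq_top_iff.2 fun z _ => ?_)
    obtain ⟨⟨x, hx⟩, rfl⟩ := hqs z
    change x ∈ J at hx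
    have hx' := hx
    rw [← h1] at hx'
    obtain ⟨_, h2⟩ := (hT x).1 hx'
    -- If T = J, a local unit gives x = e * x * e, whose class is in A.
    obtain ⟨e, he, he'⟩ := hu x
    have h3 : e * x * e = x := by rw [he, he']
    convert h2 e e using 3
    exact Subtype.ext h3.symm

/-! ### Passing between R and ℤ ⊕ R. -/

namespace WithIdentity

theorem incl_injective : Function.Injective (incl : R →ₙ+* WithIdentity R) :=
  Unitization.inr_injective

theorem mul_incl (w : WithIdentity R) (x : R) :
    w * incl x = incl ((w : Unitization ℤ R).fst • x + (w : Unitization ℤ R).snd * x) := by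
  have h (w : Unitization ℤ R) :
      w * (Unitization.inr x : Unitization ℤ R) = Unitization.inr (w.fst • x + w.snd * x : R) := by
    ext <;> simp only [Unitization.fst_mul, Unitization.snd_mul, Unitization.fst_inr,
      Unitization.snd_inr, mul_zero, zero_smul, add_zero]
  exact h w

/-- A two-sided ideal of `R`, as a left ideal of `ℤ ⊕ R`. -/
def idealSubmodule (I : TwoSidedIdeal R) : Submodule (WithIdentity R) (WithIdentity R) where
  carrier := {w | ∃ x ∈ I, incl x = w}
  zero_mem' := ⟨0, I.zero_mem, map_zero _⟩
  add_mem' := by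
    rintro _ _ ⟨x, hx, rfl⟩ ⟨y, hy, rfl⟩
    exact ⟨x + y, I.add_mem hx hy, map_add _ _ _⟩
  smul_mem' := by
    rintro w _ ⟨x, hx, rfl⟩
    exact ⟨_, I.add_mem (I.zsmul_mem _ hx) (I.mul_mem_left _ _ hx), (mul_incl w x).symm⟩

theorem incl_mem_idealSubmodule {I : TwoSidedIdeal R} {x : R} :
    incl x ∈ idealSubmodule I ↔ x ∈ I := by
  constructor
  · rintro ⟨y, hy, h⟩
    rwa [← incl_injective h]
  · exact fun h => ⟨x, h, rfl⟩

theorem isUnitaryLeftModule_of_forall {M : Type*} [AddCommGroup M] [Module (WithIdentity R) M]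
    (h : ∀ m : M, ∃ (a : R) (m' : M), m = incl a • m') : IsUnitaryLeftModule R M :=
  eq_top_iff.2 fun m _ => AddSubgroup.subset_closure (h m)

end WithIdentity

open WithIdentity

/-- Let `J` cover `I`, and let `M` be a module annihilated by `I` but not by `J`. Then an element
of `J` that annihilates `M` lies in `I`. -/
theorem TwoSidedIdeal.mem_of_forall_smul_eq_zero {I J : TwoSidedIdeal R} (hIJ : I ⋖ J)
    {M : Type*} [AddCommGroup M] [Module (WithIdentity R) M]
    (hI : ∀ x ∈ I, ∀ m : M, incl x • m = 0) (hJ : ∃ x ∈ J, ∃ m : M, incl x • m ≠ 0)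
    {x : R} (hx : x ∈ J) (h : ∀ m : M, incl x • m = 0) : x ∈ I := by
  let T : TwoSidedIdeal R := TwoSidedIdeal.mk' {y | y ∈ J ∧ ∀ m : M, incl y • m = 0}
    ⟨J.zero_mem, fun m => by simp⟩
    (fun hx hy => ⟨J.add_mem hx.1 hy.1, fun m => by
      rw [map_add, add_smul, hx.2, hy.2, add_zero]⟩)
    (fun hx => ⟨J.neg_mem hx.1, fun m => by rw [map_neg, neg_smul, hx.2, neg_zero]⟩)
    (fun {x y} hy => ⟨J.mul_mem_left _ _ hy.1, fun m => by
      rw [map_mul, mul_smul, hy.2, smul_zero]⟩)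
    (fun {x y} hx => ⟨J.mul_mem_right _ _ hx.1, fun m => by rw [map_mul, mul_smul, hx.2]⟩)
  have hT : ∀ y, y ∈ T ↔ y ∈ J ∧ ∀ m : M, incl y • m = 0 :=
    fun y => TwoSidedIdeal.mem_mk' _ _ _ _ _ _ y
  rcases hIJ.eq_or_eq (c := T) (fun y hy => (hT y).2 ⟨hIJ.le hy, hI y hy⟩)
    (fun y hy => ((hT y).1 hy).1) with h1 | h1
  · rw [← h1]; exact (hT x).2 ⟨hx, h⟩
  · obtain ⟨a, ha, m, hm⟩ := hJ
    rw [← h1] at ha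
    exact absurd (((hT a).1 ha).2 m) hm

end NonUnitalGeneral

/-! ### Simple modules and steps of a maximal chain. -/

section Classification

open WithIdentity

universe u

variable {R : Type u} [NonUnitalRing R]

/-- Up to isomorphism, exactly one simple module is annihilated by `I` but not by `J`, when `J`
covers `I` and `J² ⊄ I`. -/
theorem IsSemiArtinianRing.exists_simple (hsemi : IsSemiArtinianRing R)
    (hu : ∀ x : R, ∃ e, e * x = x ∧ x * e = x) {I J : TwoSidedIdeal R} (hIJ : I ⋖ J)
    (hsq : ∃ a ∈ J, ∃ b ∈ J, a * b ∉ I) :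
    ∃ U : SimpleLeftModule R,
      ((∀ x ∈ I, ∀ m : U.carrier, incl x • m = 0) ∧
        ∃ x ∈ J, ∃ m : U.carrier, incl x • m ≠ 0) ∧
      ∀ N : SimpleLeftModule R, (∀ x ∈ I, ∀ m : N.carrier, incl x • m = 0) →
        (∃ x ∈ J, ∃ m : N.carrier, incl x • m ≠ 0) → U ≈ N := by
  -- J/I is realised inside the cyclic module (ℤ ⊕ R)/I, because maps out of a cyclic module are
  -- given by the image of 1.
  let Q := (WithIdentity R) ⧸ idealSubmodule I
  let D : Submodule (WithIdentity R) Q := (idealSubmodule J).map (idealSubmodule I).mkQ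
  have hmk : ∀ x : R, (idealSubmodule I).mkQ (incl x) = 0 ↔ x ∈ I := fun x => by
    rw [Submodule.mkQ_apply, Submodule.Quotient.mk_eq_zero, incl_mem_idealSubmodule]
  have hD : ∀ d ∈ D, ∃ x ∈ J, (idealSubmodule I).mkQ (incl x) = d := by
    rintro _ ⟨_, ⟨x, hx, rfl⟩, rfl⟩
    exact ⟨x, hx, rfl⟩
  have hDJ : ∀ x ∈ J, (idealSubmodule I).mkQ (incl x) ∈ D := fun x hx =>
    ⟨_, ⟨x, hx, rfl⟩, rfl⟩
  have hsm : ∀ r x : R, incl r • (idealSubmodule I).mkQ (incl x) =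
      (idealSubmodule I).mkQ (incl (r * x)) := fun r x => by
    rw [← map_smul, smul_eq_mul, ← map_mul incl]
  have hDnt : Nontrivial D := by
    obtain ⟨x, hxJ, hxI⟩ := SetLike.exists_of_lt hIJ.lt
    exact ⟨⟨_, hDJ x hxJ⟩, 0, fun h => hxI ((hmk x).1 (congrArg Subtype.val h))⟩
  have hDun : IsUnitaryLeftModule R D := by
    refine isUnitaryLeftModule_of_forall ?_
    rintro ⟨d, hd⟩
    obtain ⟨x, hx, rfl⟩ := hD d hd
    obtain ⟨e, he, -⟩ := hu x
    refine ⟨e, ⟨_, hd⟩, Subtype.ext ?_⟩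
    change _ = incl e • (idealSubmodule I).mkQ (incl x)
    rw [hsm, he]
  obtain ⟨S, hS⟩ := hsemi D hDnt hDun
  have hSel : ∀ s : S, ∃ x ∈ J, (idealSubmodule I).mkQ (incl x) = ((s : D) : Q) :=
    fun s => hD _ (s : D).2
  have hSI : ∀ x ∈ I, ∀ m : S, incl x • m = 0 := by
    intro x hx m
    obtain ⟨y, -, hy⟩ := hSel m
    refine Subtype.ext (Subtype.ext ?_)
    change incl x • ((m : D) : Q) = 0
    rw [← hy, hsm, hmk]
    exact I.mul_mem_right _ _ hx
  have := hS.1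
  have hSnt : Nontrivial S := IsSimpleModule.nontrivial (WithIdentity R) S
  obtain ⟨u, hu0⟩ := exists_ne (0 : S)
  obtain ⟨x, hxJ, hxu⟩ := hSel u
  have hxI : x ∉ I := fun h => hu0 <| Subtype.ext <| Subtype.ext <| by
    rw [← hxu, (hmk x).2 h]; rfl
  refine ⟨⟨S, hS⟩, ⟨hSI, ?_⟩, ?_⟩
  · by_contra hcon
    push Not at hcon
    -- If J killed S, it would kill the class u of x, so Jx ⊆ I and x would be in I.
    refine hxI (TwoSidedIdeal.mem_of_forall_mul_mem hIJ hsq hxJ fun j hj => ?_)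
    rw [← hmk, ← hsm, hxu]
    exact congrArg (fun t : S => ((t : D) : Q)) (hcon j hj u)
  · intro N hNI hNJ
    have hN := N.simple.1
    obtain ⟨m, hm⟩ : ∃ m : N.carrier, incl x • m ≠ 0 := by
      by_contra hcon
      push Not at hcon
      exact hxI (TwoSidedIdeal.mem_of_forall_smul_eq_zero hIJ hNI hNJ hxJ hcon)
    -- w ↦ w • m descends to Q because I kills N; its restriction to S sends u to x • m ≠ 0.
    let φ : Q →ₗ[(WithIdentity R)] N.carrier := (idealSubmodule I).liftQ (LinearMap.toSpanSingleton (WithIdentity R) _ m) (by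
      rintro _ ⟨y, hy, rfl⟩
      exact hNI y hy m)
    let ψ : S →ₗ[(WithIdentity R)] N.carrier := φ ∘ₗ D.subtype ∘ₗ S.subtype
    have hψ : ψ u = incl x • m := by
      change φ ((u : D) : Q) = _
      rw [← hxu]
      exact (Submodule.liftQ_apply _ _ _).trans (LinearMap.toSpanSingleton_apply _ _ _ _)
    have hψ0 : ψ ≠ 0 := fun h => hm (by rw [← hψ, h]; rfl)
    have hb : Function.Bijective ψ := (@LinearMap.bijective_or_eq_zero (WithIdentity R) _ S _ _ N.carrier _ _ _ _ ψ).resolve_right hψ0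
    exact ⟨LinearEquiv.ofBijective ψ hb⟩

theorem IsMaximalIdealChain.le_of_le {n : ℕ} {S : Fin (n + 1) → TwoSidedIdeal R}
    (hS : IsMaximalIdealChain S) : Monotone S :=
  Fin.monotone_iff_le_succ.2 fun i => (hS.step i).le

/-- Every simple module sits in exactly one step of a maximal chain of ideals. -/
theorem IsMaximalIdealChain.existsUnique {n : ℕ} {S : Fin (n + 1) → TwoSidedIdeal R}
    (hS : IsMaximalIdealChain S) (M : SimpleLeftModule R) :
    ∃! i : Fin n, (∀ x ∈ S i.castSucc, ∀ m : M.carrier, incl x • m = 0) ∧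
      ∃ x ∈ S i.succ, ∃ m : M.carrier, incl x • m ≠ 0 := by
  let P : Fin (n + 1) → Prop := fun i => ∀ x ∈ S i, ∀ m : M.carrier, incl x • m = 0
  have hP0 : P 0 := by
    intro x hx m
    rw [hS.bot, TwoSidedIdeal.mem_bot] at hx
    rw [hx, map_zero, zero_smul]
  have hPn : ¬ P (Fin.last n) := by
    obtain ⟨a, m, ham⟩ := M.simple.2
    refine fun h => ham (h a ?_ m)
    rw [hS.top]
    trivial
  -- Otherwise annihilation would propagate from S 0 = 0 up to the whole ring.
  have hex : ∃ i : Fin n, P i.castSucc ∧ ¬ P i.succ := by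
    by_contra hcon
    push Not at hcon
    exact hPn (Fin.induction hP0 (fun i hi => hcon i hi) (Fin.last n))
  have hmono : ∀ i j, i ≤ j → P j → P i := fun i j hij h x hx m => h x (hS.le_of_le hij hx) m
  obtain ⟨i, hi, hi'⟩ := hex
  refine ⟨i, ⟨hi, by simpa [P] using hi'⟩, ?_⟩
  rintro j ⟨hj, hj'⟩
  have hj' : ¬ P j.succ := by simpa [P] using hj'
  rcases lt_trichotomy j i with h | h | h
  · exact absurd (hmono _ _ (Fin.succ_le_castSucc_iff.2 h) hi) hj'
  · exact h
  · exact absurd (hmono _ _ (Fin.succ_le_castSucc_iff.2 h) hj) hi'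

/-- Over a semi-artinian ring with local units whose ideals `I < J` satisfy `J² ⊄ I`, the simple
modules correspond to the steps of any maximal chain of ideals. -/
theorem IsMaximalIdealChain.nonempty_equiv (hsemi : IsSemiArtinianRing R)
    (hu : ∀ x : R, ∃ e, e * x = x ∧ x * e = x)
    (hsq : ∀ I J : TwoSidedIdeal R, I < J → ∃ a ∈ J, ∃ b ∈ J, a * b ∉ I)
    {n : ℕ} {S : Fin (n + 1) → TwoSidedIdeal R} (hS : IsMaximalIdealChain S) :
    Nonempty (SimpleModuleClasses R ≃ Fin n) := by
  choose U hU hU' using fun i : Fin n =>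
    hsemi.exists_simple hu (hS.step i) (hsq _ _ (hS.step i).lt)
  refine ⟨(Equiv.ofBijective (fun i => (Quotient.mk _ (U i) : SimpleModuleClasses R))
    ⟨fun i j hij => ?_, fun c => ?_⟩).symm⟩
  · obtain ⟨f⟩ : U i ≈ U j := Quotient.exact hij
    -- Isomorphic modules have the same annihilator, so U j sits in step i as well as in step j.
    refine (hS.existsUnique (U j)).unique ⟨fun x hx m => ?_, ?_⟩ (hU j)
    · have := (hU i).1 x hx (f.symm m)
      rwa [← map_smul, LinearEquiv.map_eq_zero_iff] at this
    · obtain ⟨x, hx, m, hm⟩ := (hU i).2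
      refine ⟨x, hx, f m, ?_⟩
      rwa [← map_smul, Ne, LinearEquiv.map_eq_zero_iff]
  · induction c using Quotient.inductionOn with
    | h N =>
      obtain ⟨i, hi, -⟩ := hS.existsUnique N
      exact ⟨i, Quotient.sound (hU' i N hi.1 hi.2)⟩

/-- A finite order is well-founded in both directions, so successive covers starting at ⊥ reach ⊤.
-/
theorem exists_isMaximalIdealChain [Finite (TwoSidedIdeal R)] :
    ∃ (n : ℕ) (S : Fin (n + 1) → TwoSidedIdeal R), IsMaximalIdealChain S := by
  obtain ⟨a, h0, n, hn, h⟩ := exists_covBy_seq_of_wellFoundedLT_wellFoundedGT (TwoSidedIdeal R)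
  exact ⟨n, fun i => a i, ⟨h0.eq_bot, hn.eq_top, fun i => h i i.2⟩⟩

end Classification

/-! ### The defining relations inside the Leavitt path algebra. -/

namespace DirectedGraph

variable {E : DirectedGraph.{uV, uE}} {K : Type uK} [Field K]

namespace LeavittPathAlgebra

/-- The inclusion of `L_K(E)` in the unital algebra with the same presentation. -/
def toUnital : E.LeavittPathAlgebra K →ₙₐ[K] E.UnitalLeavittAlgebra K :=
  NonUnitalSubalgebraClass.subtype (E.leavittSubalgebra K)

theorem toUnital_injective : Function.Injective (toUnital : E.LeavittPathAlgebra K → _) :=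
  Subtype.val_injective

/-- The generators of `L_K(E)`. -/
def gen (K : Type uK) [Field K] (g : E.Generator) : E.LeavittPathAlgebra K :=
  ⟨E.leavittGen K g, NonUnitalAlgebra.subset_adjoin K ⟨g, rfl⟩⟩

theorem toUnital_gen (g : E.Generator) : toUnital (gen K g) = E.leavittGen K g := rfl

/-- A vertex, as an element of `L_K(E)`. -/
abbrev vert (K : Type uK) [Field K] (v : E.vertex) : E.LeavittPathAlgebra K := gen K (.vert v)

/-- An edge, as an element of `L_K(E)`. -/
abbrev real (K : Type uK) [Field K] (e : E.edge) : E.LeavittPathAlgebra K := gen K (.real e)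

/-- A ghost edge, as an element of `L_K(E)`. -/
abbrev ghost (K : Type uK) [Field K] (e : E.edge) : E.LeavittPathAlgebra K := gen K (.ghost e)

@[elab_as_elim]
theorem induction {p : E.LeavittPathAlgebra K → Prop} (hgen : ∀ g, p (gen K g)) (hzero : p 0)
    (hadd : ∀ x y, p x → p y → p (x + y)) (hmul : ∀ x y, p x → p y → p (x * y))
    (hsmul : ∀ (c : K) x, p x → p (c • x)) (x : E.LeavittPathAlgebra K) : p x := by
  obtain ⟨x, hx⟩ := x
  refine NonUnitalAlgebra.adjoin_induction (p := fun x hx => p ⟨x, hx⟩) ?_ ?_ hzero ?_ ?_ hx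
  · rintro _ ⟨g, rfl⟩
    exact hgen g
  · exact fun x y hx hy h h' => hadd ⟨x, hx⟩ ⟨y, hy⟩ h h'
  · exact fun x y hx hy h h' => hmul ⟨x, hx⟩ ⟨y, hy⟩ h h'
  · exact fun c x hx h => hsmul c ⟨x, hx⟩ h

theorem leavittGen_mul (g h : E.Generator) : E.leavittGen K g * E.leavittGen K h =
    RingQuot.mkAlgHom K (LeavittRel E K) (FreeAlgebra.ι K g * FreeAlgebra.ι K h) :=
  (map_mul _ _ _).symm

theorem gen_mul_eq {g h k : E.Generator}
    (H : LeavittRel E K (FreeAlgebra.ι K g * FreeAlgebra.ι K h) (FreeAlgebra.ι K k)) :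
    gen K g * gen K h = gen K k := by
  apply toUnital_injective
  rw [map_mul, toUnital_gen, toUnital_gen, toUnital_gen, leavittGen_mul,
    RingQuot.mkAlgHom_rel K H]
  rfl

theorem gen_mul_eq_zero {g h : E.Generator}
    (H : LeavittRel E K (FreeAlgebra.ι K g * FreeAlgebra.ι K h) 0) :
    gen K g * gen K h = 0 := by
  apply toUnital_injective
  rw [map_mul, toUnital_gen, toUnital_gen, leavittGen_mul, RingQuot.mkAlgHom_rel K H, map_zero,
    map_zero]

theorem vert_mul_self (v : E.vertex) : vert K v * vert K v = vert K v := gen_mul_eq (.vert_idem v)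

theorem vert_mul_of_ne {v w : E.vertex} (h : v ≠ w) : vert K v * vert K w = 0 :=
  gen_mul_eq_zero (.vert_orth v w h)

theorem source_mul_real (e : E.edge) : vert K (E.s e) * real K e = real K e :=
  gen_mul_eq (.source_real e)

theorem real_mul_range (e : E.edge) : real K e * vert K (E.r e) = real K e :=
  gen_mul_eq (.real_range e)

theorem range_mul_ghost (e : E.edge) : vert K (E.r e) * ghost K e = ghost K e :=
  gen_mul_eq (.range_ghost e)

theorem ghost_mul_source (e : E.edge) : ghost K e * vert K (E.s e) = ghost K e :=
  gen_mul_eq (.ghost_source e)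

theorem ghost_mul_real (e : E.edge) : ghost K e * real K e = vert K (E.r e) :=
  gen_mul_eq (.ck1_same e)

theorem ghost_mul_real_of_ne {e f : E.edge} (h : e ≠ f) : ghost K e * real K f = 0 :=
  gen_mul_eq_zero (.ck1_ne e f h)

theorem vert_mul_real_of_ne {v : E.vertex} {e : E.edge} (h : v ≠ E.s e) :
    vert K v * real K e = 0 := by
  rw [← source_mul_real, ← mul_assoc, vert_mul_of_ne h, zero_mul]

theorem ghost_mul_vert_of_ne {v : E.vertex} {e : E.edge} (h : E.s e ≠ v) :
    ghost K e * vert K v = 0 := by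
  rw [← ghost_mul_source, mul_assoc, vert_mul_of_ne h, mul_zero]

/-! ### Local units -/

theorem sum_vert_mul_vert {F : Finset E.vertex} {v : E.vertex} (hv : v ∈ F) :
    (∑ w ∈ F, vert K w) * vert K v = vert K v := by
  rw [Finset.sum_mul, Finset.sum_eq_single_of_mem v hv fun w _ h => vert_mul_of_ne h,
    vert_mul_self]

theorem vert_mul_sum_vert {F : Finset E.vertex} {v : E.vertex} (hv : v ∈ F) :
    vert K v * (∑ w ∈ F, vert K w) = vert K v := by
  rw [Finset.mul_sum, Finset.sum_eq_single_of_mem v hv fun w _ h => vert_mul_of_ne h.symm,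
    vert_mul_self]

open Classical in
/-- Finite sums of distinct vertices are local units. -/
theorem exists_sum_vert (x : E.LeavittPathAlgebra K) : ∃ F : Finset E.vertex, ∀ G, F ⊆ G →
    (∑ v ∈ G, vert K v) * x = x ∧ x * (∑ v ∈ G, vert K v) = x := by
  refine induction ?_ ⟨∅, by simp⟩ ?_ ?_ ?_ x
  · rintro (v | e | e)
    · exact ⟨{v}, fun G hG => ⟨sum_vert_mul_vert (hG (by simp)), vert_mul_sum_vert (hG (by simp))⟩⟩
    · refine ⟨{E.s e, E.r e}, fun G hG => ⟨?_, ?_⟩⟩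
      · change _ * real K e = real K e
        rw [← source_mul_real, ← mul_assoc, sum_vert_mul_vert (hG (by simp))]
      · change real K e * _ = real K e
        rw [← real_mul_range, mul_assoc, vert_mul_sum_vert (hG (by simp))]
    · refine ⟨{E.s e, E.r e}, fun G hG => ⟨?_, ?_⟩⟩
      · change _ * ghost K e = ghost K e
        rw [← range_mul_ghost, ← mul_assoc, sum_vert_mul_vert (hG (by simp))]
      · change ghost K e * _ = ghost K e
        rw [← ghost_mul_source, mul_assoc, vert_mul_sum_vert (hG (by simp))]
  · rintro x y ⟨F, hF⟩ ⟨F', hF'⟩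
    -- The claim holds for all larger sets of vertices, so the union serves both elements.
    refine ⟨F ∪ F', fun G hG => ?_⟩
    obtain ⟨h1, h2⟩ := hF G (Finset.union_subset_left hG)
    obtain ⟨h3, h4⟩ := hF' G (Finset.union_subset_right hG)
    rw [mul_add, add_mul, h1, h2, h3, h4]
    exact ⟨rfl, rfl⟩
  · rintro x y ⟨F, hF⟩ ⟨F', hF'⟩
    refine ⟨F ∪ F', fun G hG => ?_⟩
    obtain ⟨h1, h2⟩ := hF G (Finset.union_subset_left hG)
    obtain ⟨h3, h4⟩ := hF' G (Finset.union_subset_right hG)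
    rw [← mul_assoc, h1, mul_assoc, h4]
    exact ⟨rfl, rfl⟩
  · rintro c x ⟨F, hF⟩
    refine ⟨F, fun G hG => ?_⟩
    rw [mul_smul_comm, smul_mul_assoc, (hF G hG).1, (hF G hG).2]
    exact ⟨rfl, rfl⟩

theorem exists_local_unit (x : E.LeavittPathAlgebra K) : ∃ e, e * x = x ∧ x * e = x := by
  obtain ⟨F, hF⟩ := exists_sum_vert x
  exact ⟨_, hF F subset_rfl⟩

/-- Ring ideals are K-subspaces thanks to local units: c • x = (c • e) * x. -/
theorem smul_mem (I : TwoSidedIdeal (E.LeavittPathAlgebra K)) (c : K)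
    {x : E.LeavittPathAlgebra K} (hx : x ∈ I) : c • x ∈ I := by
  obtain ⟨e, he, -⟩ := exists_local_unit x
  rw [← he, ← smul_mul_assoc]
  exact I.mul_mem_left _ _ hx

theorem mem_of_forall_mul_vert_mem {I : TwoSidedIdeal (E.LeavittPathAlgebra K)}
    {x : E.LeavittPathAlgebra K} (h : ∀ v, x * vert K v ∈ I) : x ∈ I := by
  obtain ⟨F, hF⟩ := exists_sum_vert x
  rw [← (hF F subset_rfl).2, Finset.mul_sum]
  exact sum_mem fun v _ => h v

/-! ### Paths -/

/-- The list `l` of edges is a path from `u` to `w`. -/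
def IsPath (E : DirectedGraph.{uV, uE}) : E.vertex → List E.edge → E.vertex → Prop
  | u, [], w => u = w
  | u, e :: l, w => E.s e = u ∧ IsPath E (E.r e) l w

/-- The product of the edges in `l`, followed by the vertex `v`. -/
def pathElt (K : Type uK) [Field K] : List E.edge → E.vertex → E.LeavittPathAlgebra K
  | [], v => vert K v
  | e :: l, v => real K e * pathElt K l v

/-- The adjoint of `pathElt K l v`. -/
def ghostPathElt (K : Type uK) [Field K] : List E.edge → E.vertex → E.LeavittPathAlgebra K
  | [], v => vert K v
  | e :: l, v => ghostPathElt K l v * ghost K e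

theorem pathElt_mul_vert (l : List E.edge) (v : E.vertex) :
    pathElt K l v * vert K v = pathElt K l v := by
  induction l with
  | nil => exact vert_mul_self v
  | cons e l ih => rw [pathElt, mul_assoc, ih]

theorem pathElt_mul_vert_of_ne (l : List E.edge) {v w : E.vertex} (h : v ≠ w) :
    pathElt K l v * vert K w = 0 := by
  rw [← pathElt_mul_vert, mul_assoc, vert_mul_of_ne h, mul_zero]

theorem vert_mul_pathElt {u v : E.vertex} {l : List E.edge} (h : IsPath E u l v) :
    vert K u * pathElt K l v = pathElt K l v := by
  cases l with
  | nil =>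
    cases h
    exact vert_mul_self _
  | cons e l =>
    obtain ⟨rfl, -⟩ := h
    rw [pathElt, ← mul_assoc, source_mul_real]

theorem vert_mul_pathElt_of_not {u v : E.vertex} {l : List E.edge} (h : ¬ IsPath E u l v) :
    vert K u * pathElt K l v = 0 := by
  induction l generalizing u with
  | nil => exact vert_mul_of_ne h
  | cons e l ih =>
    rw [pathElt, ← mul_assoc]
    by_cases hs : E.s e = u
    · rw [← real_mul_range, mul_assoc, mul_assoc, ih fun h' => h ⟨hs, h'⟩, mul_zero, mul_zero]
    · rw [vert_mul_real_of_ne (Ne.symm hs), zero_mul]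

theorem ghostPathElt_mul_vert_of_not {u v : E.vertex} {l : List E.edge} (h : ¬ IsPath E u l v) :
    ghostPathElt K l v * vert K u = 0 := by
  induction l generalizing u with
  | nil => exact vert_mul_of_ne (Ne.symm h)
  | cons e l ih =>
    rw [ghostPathElt, mul_assoc]
    by_cases hs : E.s e = u
    · rw [← range_mul_ghost, mul_assoc, ← mul_assoc, ih fun h' => h ⟨hs, h'⟩, zero_mul]
    · rw [ghost_mul_vert_of_ne hs, mul_zero]

theorem ghostPathElt_mul_pathElt {u v : E.vertex} {l : List E.edge} (h : IsPath E u l v) :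
    ghostPathElt K l v * pathElt K l v = vert K v := by
  induction l generalizing u with
  | nil => exact vert_mul_self v
  | cons e l ih =>
    rw [ghostPathElt, pathElt, mul_assoc, ← mul_assoc (ghost K e), ghost_mul_real,
      vert_mul_pathElt h.2, ih h.2]

/-- Every closed path is trivial. -/
def IsAcyclic (E : DirectedGraph.{uV, uE}) : Prop :=
  ∀ (v : E.vertex) (l : List E.edge), IsPath E v l v → l = []

/-- The product survives only if one path extends the other. Both end at v, so the extension would
be a nontrivial closed path at v. Lists that are not paths are absorbed by the vanishing lemmas. -/
theorem ghostPathElt_mul_pathElt_of_ne (hE : IsAcyclic E) {v : E.vertex} {l l' : List E.edge}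
    (h : l ≠ l') : ghostPathElt K l v * pathElt K l' v = 0 := by
  induction l generalizing l' with
  | nil =>
    exact vert_mul_pathElt_of_not fun hp => h (hE v l' hp).symm
  | cons e l ih =>
    cases l' with
    | nil => exact ghostPathElt_mul_vert_of_not fun hp => h (hE v _ hp)
    | cons f l' =>
      rw [ghostPathElt, pathElt, mul_assoc, ← mul_assoc (ghost K e)]
      by_cases hef : e = f
      · subst hef
        rw [ghost_mul_real]
        by_cases hp : IsPath E (E.r e) l' v
        · rw [vert_mul_pathElt hp, ih fun h' => h (by rw [h'])]
        · rw [vert_mul_pathElt_of_not hp, mul_zero]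
      · rw [ghost_mul_real_of_ne hef, zero_mul, mul_zero]

theorem exists_isPath_of_ne_zero {v : E.vertex} {l : List E.edge} (h : pathElt K l v ≠ 0) :
    ∃ u, IsPath E u l v := by
  cases l with
  | nil => exact ⟨v, rfl⟩
  | cons e l =>
    refine ⟨E.s e, ?_⟩
    by_contra hp
    have := vert_mul_pathElt_of_not (K := K) hp
    rw [pathElt, ← mul_assoc, source_mul_real] at this
    exact h this

/-! ### The filtration by ghost length -/

/-- The span of the paths of `E` in `L_K(E)`. -/
def pathSpan (E : DirectedGraph.{uV, uE}) (K : Type uK) [Field K] :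
    Submodule K (E.LeavittPathAlgebra K) :=
  Submodule.span K (Set.range fun p : List E.edge × E.vertex => pathElt K p.1 p.2)

/-- Elements that are combinations of products `p q*` of paths, with `q` of length at most `N`. -/
def ghostFiltration (E : DirectedGraph.{uV, uE}) (K : Type uK) [Field K] :
    ℕ → Submodule K (E.LeavittPathAlgebra K)
  | 0 => pathSpan E K
  | N + 1 => pathSpan E K ⊔ Submodule.span K
      {x | ∃ y ∈ ghostFiltration E K N, ∃ e : E.edge, x = y * ghost K e}

theorem pathSpan_le_ghostFiltration (N : ℕ) : pathSpan E K ≤ ghostFiltration E K N := by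
  cases N with
  | zero => exact le_rfl
  | succ N => exact le_sup_left

theorem vert_mem_pathSpan (v : E.vertex) : vert K v ∈ pathSpan E K :=
  Submodule.subset_span ⟨([], v), rfl⟩

theorem pathElt_mul_real_mem (l : List E.edge) (v : E.vertex) (e : E.edge) :
    pathElt K l v * real K e ∈ pathSpan E K := by
  have key : ∀ l : List E.edge, pathElt K l (E.s e) * real K e = pathElt K (l ++ [e]) (E.r e) := by
    intro l
    induction l with
    | nil => exact (source_mul_real e).trans (real_mul_range e).symm
    | cons f l ih => rw [pathElt, mul_assoc, ih]; rfl
  by_cases h : v = E.s e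
  · rw [h, key]
    exact Submodule.subset_span ⟨(_, _), rfl⟩
  · rw [← pathElt_mul_vert, mul_assoc, vert_mul_real_of_ne h, mul_zero]
    exact zero_mem _

theorem pathSpan_mul_real_mem {x : E.LeavittPathAlgebra K} (hx : x ∈ pathSpan E K) (e : E.edge) :
    x * real K e ∈ pathSpan E K := by
  induction hx using Submodule.span_induction with
  | mem x hx => obtain ⟨p, rfl⟩ := hx; exact pathElt_mul_real_mem _ _ _
  | zero => rw [zero_mul]; exact zero_mem _
  | add x y _ _ hx hy => rw [add_mul]; exact add_mem hx hy
  | smul c x _ hx => rw [smul_mul_assoc]; exact Submodule.smul_mem _ _ hx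

theorem pathSpan_mul_vert_mem {x : E.LeavittPathAlgebra K} (hx : x ∈ pathSpan E K)
    (v : E.vertex) : x * vert K v ∈ pathSpan E K := by
  induction hx using Submodule.span_induction with
  | mem x hx =>
    obtain ⟨⟨l, w⟩, rfl⟩ := hx
    by_cases h : w = v
    · subst h
      rw [pathElt_mul_vert]
      exact Submodule.subset_span ⟨(_, _), rfl⟩
    · rw [pathElt_mul_vert_of_ne _ h]
      exact zero_mem _
  | zero => rw [zero_mul]; exact zero_mem _
  | add x y _ _ hx hy => rw [add_mul]; exact add_mem hx hy
  | smul c x _ hx => rw [smul_mul_assoc]; exact Submodule.smul_mem _ _ hx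

theorem mul_ghost_mem_ghostFiltration {N : ℕ} {y : E.LeavittPathAlgebra K}
    (hy : y ∈ ghostFiltration E K N) (e : E.edge) : y * ghost K e ∈ ghostFiltration E K (N + 1) :=
  Submodule.mem_sup_right (Submodule.subset_span ⟨y, hy, e, rfl⟩)

/-- Linear statements need checking only on paths and on products ending in a ghost edge; zero is
covered by the path case. -/
theorem ghostFiltration_succ_induction {N : ℕ}
    {p : (x : E.LeavittPathAlgebra K) → x ∈ ghostFiltration E K (N + 1) → Prop}
    (hpath : ∀ x (hx : x ∈ pathSpan E K), p x (pathSpan_le_ghostFiltration _ hx))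
    (hghost : ∀ y (hy : y ∈ ghostFiltration E K N) e,
      p (y * ghost K e) (mul_ghost_mem_ghostFiltration hy e))
    (hadd : ∀ x y hx hy, p x hx → p y hy → p (x + y) (add_mem hx hy))
    (hsmul : ∀ (c : K) x hx, p x hx → p (c • x) (Submodule.smul_mem _ c hx))
    {x : E.LeavittPathAlgebra K} (hx : x ∈ ghostFiltration E K (N + 1)) : p x hx := by
  obtain ⟨y, hy, z, hz, rfl⟩ := Submodule.mem_sup.1 hx
  refine hadd _ _ (pathSpan_le_ghostFiltration _ hy) (Submodule.mem_sup_right hz) (hpath y hy) ?_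
  clear hx hy y
  induction hz using Submodule.span_induction with
  | mem x hx => obtain ⟨y, hy, e, rfl⟩ := hx; exact hghost y hy e
  | zero => exact hpath 0 (zero_mem _)
  | add x y hx' hy' hx hy => exact hadd _ _ _ _ hx hy
  | smul c x hx' hx => exact hsmul _ _ _ hx

/-- Since f* e is zero or a vertex, a real edge on the right cancels a final ghost edge. This is the
descent in `exists_pathSpan_mul_gap_mem`. -/
theorem ghostFiltration_succ_mul_real_mem {N : ℕ} {x : E.LeavittPathAlgebra K}
    (hx : x ∈ ghostFiltration E K (N + 1)) (e : E.edge)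
    (hv : ∀ y ∈ ghostFiltration E K N, ∀ v, y * vert K v ∈ ghostFiltration E K N) :
    x * real K e ∈ ghostFiltration E K N := by
  induction hx using ghostFiltration_succ_induction with
  | hpath x hx => exact pathSpan_le_ghostFiltration _ (pathSpan_mul_real_mem hx e)
  | hghost y hy f =>
    rw [mul_assoc]
    by_cases h : f = e
    · rw [h, ghost_mul_real]
      exact hv y hy _
    · rw [ghost_mul_real_of_ne h, mul_zero]
      exact zero_mem _
  | hadd x y _ _ hx hy => rw [add_mul]; exact add_mem hx hy
  | hsmul c x _ hx => rw [smul_mul_assoc]; exact Submodule.smul_mem _ _ hx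

theorem ghostFiltration_mul_vert_mem {N : ℕ} {x : E.LeavittPathAlgebra K}
    (hx : x ∈ ghostFiltration E K N) (v : E.vertex) : x * vert K v ∈ ghostFiltration E K N := by
  cases N with
  | zero => exact pathSpan_mul_vert_mem hx v
  | succ N =>
    induction hx using ghostFiltration_succ_induction with
    | hpath x hx => exact pathSpan_le_ghostFiltration _ (pathSpan_mul_vert_mem hx v)
    | hghost y hy f =>
      rw [mul_assoc]
      by_cases h : E.s f = v
      · rw [← h, ghost_mul_source]
        exact mul_ghost_mem_ghostFiltration hy f
      · rw [ghost_mul_vert_of_ne h, mul_zero]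
        exact zero_mem _
    | hadd x y _ _ hx hy => rw [add_mul]; exact add_mem hx hy
    | hsmul c x _ hx => rw [smul_mul_assoc]; exact Submodule.smul_mem _ _ hx

theorem ghostFiltration_mono : Monotone (ghostFiltration E K) := by
  refine monotone_nat_of_le_succ fun N => ?_
  induction N with
  | zero => exact le_sup_left
  | succ N ih =>
    refine sup_le_sup_left (Submodule.span_mono ?_) _
    rintro _ ⟨y, hy, e, rfl⟩
    exact ⟨y, ih hy, e, rfl⟩

theorem exists_mem_ghostFiltration (x : E.LeavittPathAlgebra K) :
    ∃ N, x ∈ ghostFiltration E K N := by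
  -- The union of the filtration is stable under right multiplication; it contains the sums of
  -- vertices, which are local units.
  have key : ∀ x : E.LeavittPathAlgebra K, ∀ N, ∀ y ∈ ghostFiltration E K N,
      ∃ M, y * x ∈ ghostFiltration E K M := by
    intro x
    refine induction ?_ ?_ ?_ ?_ ?_ x
    · rintro (v | e | e) N y hy
      · exact ⟨N, ghostFiltration_mul_vert_mem hy v⟩
      · exact ⟨N, ghostFiltration_succ_mul_real_mem (ghostFiltration_mono N.le_succ hy) e
          fun y hy v => ghostFiltration_mul_vert_mem hy v⟩
      · exact ⟨N + 1, mul_ghost_mem_ghostFiltration hy e⟩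
    · exact fun N y _ => ⟨0, by rw [mul_zero]; exact zero_mem _⟩
    · intro a b ha hb N y hy
      obtain ⟨M, hM⟩ := ha N y hy
      obtain ⟨M', hM'⟩ := hb N y hy
      refine ⟨max M M', ?_⟩
      rw [mul_add]
      exact add_mem (ghostFiltration_mono (le_max_left _ _) hM)
        (ghostFiltration_mono (le_max_right _ _) hM')
    · intro a b ha hb N y hy
      obtain ⟨M, hM⟩ := ha N y hy
      rw [← mul_assoc]
      exact hb M _ hM
    · intro c a ha N y hy
      obtain ⟨M, hM⟩ := ha N y hy
      exact ⟨M, by rw [mul_smul_comm]; exact Submodule.smul_mem _ _ hM⟩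
  obtain ⟨F, hF⟩ := exists_sum_vert x
  rw [← (hF F subset_rfl).1]
  exact key x 0 _ (sum_mem fun v _ => vert_mem_pathSpan v)

/-! ### Idempotents in ideals -/

/-- The idempotent `v - ∑ e e*`, where `e` runs over a finite set `F` of edges leaving `v`. -/
def gap (K : Type uK) [Field K] (v : E.vertex) (F : Finset E.edge) : E.LeavittPathAlgebra K :=
  vert K v - ∑ e ∈ F, real K e * ghost K e

theorem vert_mul_gap {v : E.vertex} {F : Finset E.edge} (hF : ∀ e ∈ F, E.s e = v) :
    vert K v * gap K v F = gap K v F := by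
  rw [gap, mul_sub, vert_mul_self, Finset.mul_sum]
  congr 1
  refine Finset.sum_congr rfl fun e he => ?_
  rw [← hF e he, ← mul_assoc, source_mul_real]

/-- By orthogonality only the summand of e survives, and it cancels e* v = e*. This is the purpose
of the gap: it erases chosen ghost edges on its left. -/
theorem ghost_mul_gap_of_mem {v : E.vertex} {F : Finset E.edge} (hF : ∀ e ∈ F, E.s e = v)
    {e : E.edge} (he : e ∈ F) : ghost K e * gap K v F = 0 := by
  rw [gap, mul_sub, Finset.mul_sum, Finset.sum_eq_single_of_mem e he, ← mul_assoc, ghost_mul_real,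
    range_mul_ghost, ← hF e he, ghost_mul_source, sub_self]
  intro f _ hfe
  rw [← mul_assoc, ghost_mul_real_of_ne hfe.symm, zero_mul]

theorem ghost_mul_gap_of_ne {v : E.vertex} {F : Finset E.edge} (hF : ∀ e ∈ F, E.s e = v)
    {e : E.edge} (he : E.s e ≠ v) : ghost K e * gap K v F = 0 := by
  rw [← vert_mul_gap hF, ← mul_assoc, ghost_mul_vert_of_ne he, zero_mul]

theorem gap_mul_self {v : E.vertex} {F : Finset E.edge} (hF : ∀ e ∈ F, E.s e = v) :
    gap K v F * gap K v F = gap K v F := by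
  nth_rewrite 1 [gap]
  rw [sub_mul, vert_mul_gap hF, Finset.sum_mul]
  rw [Finset.sum_eq_zero, sub_zero]
  intro e he
  rw [mul_assoc, ghost_mul_gap_of_mem hF he, mul_zero]

-- Only finitely many ghost edges end the terms of x. Those leaving v are put in F, the others are
-- killed by the vertex v, and the path part remains. Allowing every larger G lets sums share one
-- gap.
open Classical in
theorem exists_mul_gap_eq {N : ℕ} {x : E.LeavittPathAlgebra K} (hx : x ∈ ghostFiltration E K N)
    (v : E.vertex) : ∃ F : Finset E.edge, (∀ e ∈ F, E.s e = v) ∧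
      ∀ G : Finset E.edge, F ⊆ G → (∀ e ∈ G, E.s e = v) →
        ∃ y ∈ pathSpan E K, x * gap K v G = y * gap K v G := by
  cases N with
  | zero => exact ⟨∅, by simp, fun G _ _ => ⟨x, hx, rfl⟩⟩
  | succ N =>
    induction hx using ghostFiltration_succ_induction with
    | hpath x hx => exact ⟨∅, by simp, fun G _ _ => ⟨x, hx, rfl⟩⟩
    | hghost y hy e =>
      by_cases h : E.s e = v
      · refine ⟨{e}, by simpa using h, fun G hG hGv => ⟨0, zero_mem _, ?_⟩⟩
        rw [mul_assoc, ghost_mul_gap_of_mem hGv (hG (by simp)), mul_zero, zero_mul]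
      · refine ⟨∅, by simp, fun G hG hGv => ⟨0, zero_mem _, ?_⟩⟩
        rw [mul_assoc, ghost_mul_gap_of_ne hGv h, mul_zero, zero_mul]
    | hadd x y _ _ hx hy =>
      obtain ⟨F, hF, hF'⟩ := hx
      obtain ⟨H, hH, hH'⟩ := hy
      refine ⟨F ∪ H, fun e he => (Finset.mem_union.1 he).elim (hF e) (hH e), fun G hG hGv => ?_⟩
      obtain ⟨a, ha, ha'⟩ := hF' G (Finset.union_subset_left hG) hGv
      obtain ⟨b, hb, hb'⟩ := hH' G (Finset.union_subset_right hG) hGv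
      exact ⟨a + b, add_mem ha hb, by rw [add_mul, add_mul, ha', hb']⟩
    | hsmul c x _ hx =>
      obtain ⟨F, hF, hF'⟩ := hx
      refine ⟨F, hF, fun G hG hGv => ?_⟩
      obtain ⟨a, ha, ha'⟩ := hF' G hG hGv
      exact ⟨c • a, Submodule.smul_mem _ _ ha, by rw [smul_mul_assoc, smul_mul_assoc, ha']⟩

/-- An element of `J` outside `I` can be multiplied on the right into one of the form `y * ε`,
with `y` a combination of paths and `ε` a gap idempotent. -/
theorem exists_pathSpan_mul_gap_mem {I J : TwoSidedIdeal (E.LeavittPathAlgebra K)} {N : ℕ}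
    {x : E.LeavittPathAlgebra K} (hx : x ∈ ghostFiltration E K N) (hxJ : x ∈ J) (hxI : x ∉ I) :
    ∃ y ∈ pathSpan E K, ∃ (v : E.vertex) (F : Finset E.edge), (∀ e ∈ F, E.s e = v) ∧
      y * gap K v F ∈ J ∧ y * gap K v F ∉ I := by
  induction N generalizing x with
  | zero =>
    obtain ⟨v, hv⟩ : ∃ v, x * vert K v ∉ I := by
      by_contra h
      push Not at h
      exact hxI (mem_of_forall_mul_vert_mem h)
    -- For the empty set of edges the gap is v itself.
    refine ⟨x, hx, v, ∅, by simp, J.mul_mem_right _ _ hxJ, ?_⟩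
    simpa [gap] using hv
  | succ N ih =>
    obtain ⟨v, hv⟩ : ∃ v, x * vert K v ∉ I := by
      by_contra h
      push Not at h
      exact hxI (mem_of_forall_mul_vert_mem h)
    obtain ⟨F, hF, hF'⟩ := exists_mul_gap_eq hx v
    -- Since xv = xε + ∑ x e e* is not in I, either xε is already outside I, or some x e is, with
    -- smaller ghost length.
    by_cases hg : x * gap K v F ∈ I
    · obtain ⟨e, he⟩ : ∃ e, x * real K e ∉ I := by
        by_contra h
        push Not at h
        refine hv ?_
        have : x * vert K v = x * gap K v F + ∑ e ∈ F, x * real K e * ghost K e := by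
          rw [gap, mul_sub, Finset.mul_sum]
          simp only [mul_assoc, sub_add_cancel]
        rw [this]
        exact I.add_mem hg (sum_mem fun e _ => I.mul_mem_right _ _ (h e))
      exact ih (ghostFiltration_succ_mul_real_mem hx e
        fun y hy v => ghostFiltration_mul_vert_mem hy v) (J.mul_mem_right _ _ hxJ) he
    · obtain ⟨y, hy, hxy⟩ := hF' F subset_rfl hF
      exact ⟨y, hy, v, F, hF, hxy ▸ J.mul_mem_right _ _ hxJ, hxy ▸ hg⟩

/-- Over an acyclic graph, ideals `I < J` of the Leavitt path algebra are separated by an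
idempotent. -/
theorem exists_idempotent_of_lt (hE : IsAcyclic E)
    {I J : TwoSidedIdeal (E.LeavittPathAlgebra K)} (hIJ : I < J) :
    ∃ ε ∈ J, ε ∉ I ∧ ε * ε = ε := by
  obtain ⟨x, hxJ, hxI⟩ := SetLike.exists_of_lt hIJ
  obtain ⟨N, hN⟩ := exists_mem_ghostFiltration x
  obtain ⟨y, hy, v, F, hF, hyJ, hyI⟩ := exists_pathSpan_mul_gap_mem hN hxJ hxI
  refine ⟨gap K v F, ?_, fun h => hyI (I.mul_mem_left _ _ h), gap_mul_self hF⟩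
  obtain ⟨c, rfl⟩ := (Finsupp.mem_span_range_iff_exists_finsupp).1 hy
  rw [Finsupp.sum, Finset.sum_mul] at hyI hyJ
  obtain ⟨⟨l, w⟩, hlw, hlw'⟩ : ∃ p ∈ c.support, (c p • pathElt K p.1 p.2) * gap K v F ∉ I := by
    by_contra h
    push Not at h
    exact hyI (sum_mem h)
  have hzero : ∀ (l : List E.edge) (w : E.vertex), w ≠ v → pathElt K l w * gap K v F = 0 := by
    intro l w hwv
    rw [← vert_mul_gap hF, ← mul_assoc, pathElt_mul_vert_of_ne _ hwv, zero_mul]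
  have hwv : w = v := by
    by_contra hwv
    refine hlw' ?_
    rw [smul_mul_assoc, hzero _ _ hwv, smul_zero]
    exact I.zero_mem
  subst hwv
  have hl0 : pathElt K l w ≠ 0 := by
    intro h
    refine hlw' ?_
    rw [h, smul_zero, zero_mul]
    exact I.zero_mem
  obtain ⟨u, hu⟩ := exists_isPath_of_ne_zero hl0
  have hc : c (l, w) ≠ 0 := Finsupp.mem_support_iff.1 hlw
  -- Multiplying yε by the adjoint of the chosen path p kills all other terms and turns c p ε into c
  -- ε; dividing by c puts ε in J.
  have hmem := J.mul_mem_left (ghostPathElt K l w) _ hyJ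
  rw [Finset.mul_sum, Finset.sum_eq_single_of_mem (l, w) hlw] at hmem
  · rw [smul_mul_assoc, mul_smul_comm, ← mul_assoc, ghostPathElt_mul_pathElt hu,
      vert_mul_gap hF] at hmem
    have := smul_mem J (c (l, w))⁻¹ hmem
    rwa [smul_smul, inv_mul_cancel₀ hc, one_smul] at this
  · rintro ⟨l', w'⟩ - hne
    rw [smul_mul_assoc, mul_smul_comm]
    by_cases hw' : w' = w
    · subst hw'
      rw [← mul_assoc, ghostPathElt_mul_pathElt_of_ne hE fun h => hne (by rw [h]), zero_mul,
        smul_zero]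
    · rw [hzero _ _ hw', mul_zero, smul_zero]

end LeavittPathAlgebra

end DirectedGraph

/-! ### Extending representations of R to ℤ ⊕ R. -/

namespace WithIdentity

universe u

variable {R : Type u} [NonUnitalRing R]

/-- The extension of a homomorphism into a unital ring to `ℤ ⊕ R`. -/
def lift {A : Type*} [Ring A] (ρ : R →ₙ+* A) : WithIdentity R →+* A :=
  (Unitization.lift { ρ with map_smul' := fun n x => map_zsmul ρ n x } :
    Unitization ℤ R →ₐ[ℤ] A).toRingHom

theorem lift_incl {A : Type*} [Ring A] (ρ : R →ₙ+* A) (x : R) : lift ρ (incl x) = ρ x :=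
  NonUnitalAlgHom.congr_fun (Unitization.lift.symm_apply_apply
    ({ ρ with map_smul' := fun n x => map_zsmul ρ n x } : R →ₙₐ[ℤ] A)) x

theorem exists_eq_intCast_add_incl (w : WithIdentity R) :
    ∃ (n : ℤ) (x : R), w = (n : WithIdentity R) + incl x := by
  have h (n : ℤ) : (Unitization.inl n : Unitization ℤ R) = (n : Unitization ℤ R) :=
    map_intCast (Unitization.inlRingHom ℤ R) n
  exact ⟨(w : Unitization ℤ R).fst, (w : Unitization ℤ R).snd,
    (Unitization.inl_fst_add_inr_snd_eq (w : Unitization ℤ R)).symm.trans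
      (congrArg (· + _) (h _))⟩

end WithIdentity

/-! ### Infinite paths. -/

namespace DirectedGraph

open LaurentPolynomial

/-- An infinite path in `E`. -/
structure InfinitePath (E : DirectedGraph.{uV, uE}) where
  /-- The vertices on the path. -/
  vertex : ℕ → E.vertex
  /-- The edges of the path. -/
  edge : ℕ → E.edge
  source : ∀ n, E.s (edge n) = vertex n
  range : ∀ n, E.r (edge n) = vertex (n + 1)

namespace InfinitePath

variable {E : DirectedGraph.{uV, uE}}

theorem ext_edge {ξ η : E.InfinitePath} (h : ∀ n, ξ.edge n = η.edge n) : ξ = η := by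
  have hv : ξ.vertex = η.vertex := funext fun n => by rw [← ξ.source, ← η.source, h]
  have he : ξ.edge = η.edge := funext h
  cases ξ
  cases η
  cases hv
  cases he
  rfl

/-- Removal of the first `k` edges. -/
def drop (k : ℕ) (ξ : E.InfinitePath) : E.InfinitePath where
  vertex n := ξ.vertex (n + k)
  edge n := ξ.edge (n + k)
  source n := ξ.source _
  range n := by rw [ξ.range]; congr 1; omega

theorem drop_drop (k l : ℕ) (ξ : E.InfinitePath) : (ξ.drop k).drop l = ξ.drop (k + l) :=
  ext_edge fun n => congrArg ξ.edge (by omega)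

theorem drop_zero (ξ : E.InfinitePath) : ξ.drop 0 = ξ := rfl

theorem drop_mul {ξ : E.InfinitePath} {n : ℕ} (h : ξ.drop n = ξ) (k : ℕ) :
    ξ.drop (n * k) = ξ := by
  induction k with
  | zero => rfl
  | succ k ih => rw [Nat.mul_succ, ← drop_drop, ih, h]

/-- Addition of an edge in front. -/
def cons (e : E.edge) (ξ : E.InfinitePath) (h : E.r e = ξ.vertex 0) : E.InfinitePath where
  vertex n := n.casesOn (E.s e) ξ.vertex
  edge n := n.casesOn e ξ.edge
  source n := by
    cases n with
    | zero => rfl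
    | succ n => exact ξ.source n
  range n := by
    cases n with
    | zero => exact h
    | succ n => exact ξ.range n

theorem drop_cons {e : E.edge} {ξ : E.InfinitePath} (h : E.r e = ξ.vertex 0) :
    (cons e ξ h).drop 1 = ξ :=
  ext_edge fun _ => rfl

theorem cons_drop {e : E.edge} {ξ : E.InfinitePath} (he : ξ.edge 0 = e)
    (h : E.r e = (ξ.drop 1).vertex 0) : cons e (ξ.drop 1) h = ξ :=
  ext_edge fun n => by
    cases n with
    | zero => exact he.symm
    | succ n => rfl

theorem eq_of_drop_eq {ξ η : E.InfinitePath} (he : ξ.edge 0 = η.edge 0)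
    (h : ξ.drop 1 = η.drop 1) : ξ = η :=
  ext_edge fun n => by
    cases n with
    | zero => exact he
    | succ n => exact congrFun (congrArg edge h) n

end InfinitePath

/-! ### The representation on functions of infinite paths. -/

variable (E : DirectedGraph.{uV, uE}) (K : Type uK) [Field K]

/-- Functions on the infinite paths of `E`, with values in Laurent polynomials. -/
def PathModule : Type (max uV uE uK) := E.InfinitePath → K[T;T⁻¹]

namespace PathModule

noncomputable instance : AddCommGroup (PathModule E K) :=
  inferInstanceAs (AddCommGroup (E.InfinitePath → K[T;T⁻¹]))

noncomputable instance : Module K[T;T⁻¹] (PathModule E K) :=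
  inferInstanceAs (Module K[T;T⁻¹] (E.InfinitePath → K[T;T⁻¹]))

noncomputable instance : Module K (PathModule E K) :=
  inferInstanceAs (Module K (E.InfinitePath → K[T;T⁻¹]))

instance : IsScalarTower K K[T;T⁻¹] (PathModule E K) :=
  inferInstanceAs (IsScalarTower K K[T;T⁻¹] (E.InfinitePath → K[T;T⁻¹]))

instance : SMulCommClass K[T;T⁻¹] K (PathModule E K) :=
  inferInstanceAs (SMulCommClass K[T;T⁻¹] K (E.InfinitePath → K[T;T⁻¹]))

instance : SMulCommClass K K[T;T⁻¹] (PathModule E K) :=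
  inferInstanceAs (SMulCommClass K K[T;T⁻¹] (E.InfinitePath → K[T;T⁻¹]))

variable {E K}

@[ext]
theorem ext {f g : PathModule E K} (h : ∀ η, f η = g η) : f = g := funext h

theorem add_apply (f g : PathModule E K) (η : E.InfinitePath) : (f + g) η = f η + g η := rfl

theorem smul_apply (c : K[T;T⁻¹]) (f : PathModule E K) (η : E.InfinitePath) :
    (c • f) η = c * f η := rfl

theorem zero_apply (η : E.InfinitePath) : (0 : PathModule E K) η = 0 := rfl

theorem sum_apply {ι : Type*} (s : Finset ι) (f : ι → PathModule E K) (η : E.InfinitePath) :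
    (∑ i ∈ s, f i) η = ∑ i ∈ s, f i η :=
  Finset.sum_apply η s f

open Classical in
/-- A vertex `v` acts by restriction to the paths that start at `v`. -/
noncomputable def vertOp (v : E.vertex) : Module.End K[T;T⁻¹] (PathModule E K) where
  toFun f η := if η.vertex 0 = v then f η else 0
  map_add' f g := funext fun η => by
    change (if η.vertex 0 = v then (f + g) η else 0) =
      (if η.vertex 0 = v then f η else 0) + (if η.vertex 0 = v then g η else 0)
    split_ifs <;> simp [add_apply]
  map_smul' c f := funext fun η => by
    change (if η.vertex 0 = v then (c • f) η else 0) = c * (if η.vertex 0 = v then f η else 0)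
    split_ifs <;> simp [smul_apply]

open Classical in
/-- An edge acts by prolongation of paths, and multiplication by `T`. -/
noncomputable def realOp (e : E.edge) : Module.End K[T;T⁻¹] (PathModule E K) where
  toFun f η := if η.edge 0 = e then T 1 * f (η.drop 1) else 0
  map_add' f g := funext fun η => by
    change (if η.edge 0 = e then T 1 * (f + g) (η.drop 1) else 0) =
      (if η.edge 0 = e then T 1 * f (η.drop 1) else 0) + (if η.edge 0 = e then T 1 * g (η.drop 1) else 0)
    split_ifs <;> simp [add_apply, mul_add]
  map_smul' c f := funext fun η => by
    change (if η.edge 0 = e then T 1 * (c • f) (η.drop 1) else 0) = c * (if η.edge 0 = e then T 1 * f (η.drop 1) else 0)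
    split_ifs <;> simp [smul_apply, mul_left_comm]

open Classical in
/-- A ghost edge acts by removal of the first edge of a path, and division by `T`. -/
noncomputable def ghostOp (e : E.edge) : Module.End K[T;T⁻¹] (PathModule E K) where
  toFun f η := if h : E.r e = η.vertex 0 then T (-1) * f (.cons e η h) else 0
  map_add' f g := funext fun η => by
    change (if h : E.r e = η.vertex 0 then T (-1) * (f + g) (.cons e η h) else 0) =
      (if h : E.r e = η.vertex 0 then T (-1) * f (.cons e η h) else 0) + (if h : E.r e = η.vertex 0 then T (-1) * g (.cons e η h) else 0)
    split_ifs <;> simp [add_apply, mul_add]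
  map_smul' c f := funext fun η => by
    change (if h : E.r e = η.vertex 0 then T (-1) * (c • f) (.cons e η h) else 0) = c * (if h : E.r e = η.vertex 0 then T (-1) * f (.cons e η h) else 0)
    split_ifs <;> simp [smul_apply, mul_left_comm]

open Classical in
theorem vertOp_apply (v : E.vertex) (f : PathModule E K) (η : E.InfinitePath) :
    vertOp v f η = if η.vertex 0 = v then f η else 0 := rfl

open Classical in
theorem realOp_apply (e : E.edge) (f : PathModule E K) (η : E.InfinitePath) :
    realOp e f η = if η.edge 0 = e then T 1 * f (η.drop 1) else 0 := rfl

open Classical in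
theorem ghostOp_apply (e : E.edge) (f : PathModule E K) (η : E.InfinitePath) :
    ghostOp e f η = if h : E.r e = η.vertex 0 then T (-1) * f (.cons e η h) else 0 := rfl

theorem realOp_ghostOp_apply (e : E.edge) (f : PathModule E K) {η : E.InfinitePath}
    (h : η.edge 0 = e) : realOp e (ghostOp e f) η = f η := by
  have hr : E.r e = (η.drop 1).vertex 0 := by rw [← h]; exact η.range 0
  rw [realOp_apply, if_pos h, ghostOp_apply, dif_pos hr, InfinitePath.cons_drop h, ← mul_assoc,
    ← T_add]
  simp

/-- The operators attached to the generators of the Leavitt path algebra. -/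
noncomputable def genOp : E.Generator → Module.End K[T;T⁻¹] (PathModule E K)
  | .vert v => vertOp v
  | .real e => realOp e
  | .ghost e => ghostOp e

/-- The factors T and T⁻¹ cancel in each relation between real and ghost edges. The relation at a
regular vertex holds because an infinite path leaving it has exactly one first edge. -/
theorem lift_genOp_rel {x y : FreeAlgebra K E.Generator} (h : LeavittRel E K x y) :
    FreeAlgebra.lift K (genOp (E := E) (K := K)) x = FreeAlgebra.lift K genOp y := by
  classical
  have hcons : ∀ (e : E.edge) (η : E.InfinitePath) (h : E.r e = η.vertex 0),
    (InfinitePath.cons e η h).edge 0 = e := fun _ _ _ => rfl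
  have hconsv : ∀ (e : E.edge) (η : E.InfinitePath) (h : E.r e = η.vertex 0),
    (InfinitePath.cons e η h).vertex 0 = E.s e := fun _ _ _ => rfl
  refine LinearMap.ext fun f => PathModule.ext fun η => ?_
  cases h with
  | vert_idem v =>
    simp only [map_mul, FreeAlgebra.lift_ι_apply, genOp, Module.End.mul_apply, vertOp_apply]
    split_ifs <;> rfl
  | vert_orth v w hvw =>
    simp only [map_mul, map_zero, FreeAlgebra.lift_ι_apply, genOp, Module.End.mul_apply,
      vertOp_apply, LinearMap.zero_apply, zero_apply]
    split_ifs with h1 h2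
    · exact absurd (h1.symm.trans h2) hvw
    · rfl
    · rfl
  | source_real e =>
    simp only [map_mul, FreeAlgebra.lift_ι_apply, genOp, Module.End.mul_apply, vertOp_apply,
      realOp_apply]
    split_ifs with h1 h2 h3
    · rfl
    · rfl
    · exact absurd (by rw [← η.source, h3]) h1
    · rfl
  | real_range e =>
    simp only [map_mul, FreeAlgebra.lift_ι_apply, genOp, Module.End.mul_apply, vertOp_apply,
      realOp_apply]
    split_ifs with h1 h2
    · rfl
    · exact absurd (by rw [← h1, η.range]; rfl) h2
    · rfl
  | range_ghost e =>
    simp only [map_mul, FreeAlgebra.lift_ι_apply, genOp, Module.End.mul_apply, vertOp_apply,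
      ghostOp_apply]
    split_ifs with h1 h2 h3
    · rfl
    · rfl
    · exact absurd h3.symm h1
    · rfl
  | ghost_source e =>
    simp only [map_mul, FreeAlgebra.lift_ι_apply, genOp, Module.End.mul_apply, vertOp_apply,
      ghostOp_apply, hconsv, if_true]
  | ck1_same e =>
    simp only [map_mul, FreeAlgebra.lift_ι_apply, genOp, Module.End.mul_apply, vertOp_apply,
      ghostOp_apply, realOp_apply, hcons, if_true, InfinitePath.drop_cons, eq_comm (a := E.r e)]
    split_ifs
    · rw [← mul_assoc, ← T_add]
      simp
    · rfl
  | ck1_ne e g hne =>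
    simp only [map_mul, map_zero, FreeAlgebra.lift_ι_apply, genOp, Module.End.mul_apply,
      ghostOp_apply, realOp_apply, hcons, if_neg hne, mul_zero, dite_eq_ite, ite_self,
      LinearMap.zero_apply, zero_apply]
  | ck2 v hfin hne =>
    simp only [map_mul, map_sum, FreeAlgebra.lift_ι_apply, genOp, LinearMap.sum_apply, sum_apply,
      Module.End.mul_apply, vertOp_apply]
    split_ifs with h1
    · rw [Finset.sum_eq_single_of_mem (η.edge 0), realOp_ghostOp_apply _ _ rfl]
      · rw [Set.Finite.mem_toFinset]
        exact (η.source 0).trans h1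
      · intro e _ he
        rw [realOp_apply, if_neg he.symm]
    · refine (Finset.sum_eq_zero fun e he => ?_).symm
      rw [Set.Finite.mem_toFinset] at he
      rw [realOp_apply, if_neg]
      rintro rfl
      exact h1 ((η.source 0).symm.trans he)

/-- The action of the Leavitt path algebra on functions on infinite paths. -/
noncomputable def rep (E : DirectedGraph.{uV, uE}) (K : Type uK) [Field K] :
    E.LeavittPathAlgebra K →ₙₐ[K] Module.End K[T;T⁻¹] (PathModule E K) :=
  ((RingQuot.liftAlgHom K ⟨FreeAlgebra.lift K genOp, fun _ _ h => lift_genOp_rel h⟩ :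
    E.UnitalLeavittAlgebra K →ₐ[K] Module.End K[T;T⁻¹] (PathModule E K)) :
      E.UnitalLeavittAlgebra K →ₙₐ[K] Module.End K[T;T⁻¹] (PathModule E K)).comp
    LeavittPathAlgebra.toUnital

theorem rep_gen (g : E.Generator) : rep E K (LeavittPathAlgebra.gen K g) = genOp g := by
  change RingQuot.liftAlgHom K _ (RingQuot.mkAlgHom K _ _) = _
  rw [RingQuot.liftAlgHom_mkAlgHom_apply, FreeAlgebra.lift_ι_apply]

noncomputable instance : Module (WithIdentity (E.LeavittPathAlgebra K)) (PathModule E K) :=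
  Module.compHom (PathModule E K)
    (WithIdentity.lift (rep E K : E.LeavittPathAlgebra K →ₙ+* Module.End K[T;T⁻¹] (PathModule E K)))

open WithIdentity

theorem smul_def (w : WithIdentity (E.LeavittPathAlgebra K)) (f : PathModule E K) :
    w • f = WithIdentity.lift
      (rep E K : E.LeavittPathAlgebra K →ₙ+* Module.End K[T;T⁻¹] (PathModule E K)) w f := rfl

theorem incl_smul (x : E.LeavittPathAlgebra K) (f : PathModule E K) :
    incl x • f = rep E K x f := by
  rw [smul_def, lift_incl]
  rfl

/-- L acts by Laurent-linear operators; this later turns generation by one element into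
invertibility of a scalar. -/
theorem smul_smul_comm (w : WithIdentity (E.LeavittPathAlgebra K)) (c : K[T;T⁻¹])
    (f : PathModule E K) : w • c • f = c • w • f := by
  rw [smul_def, map_smul]
  rfl

/-- The product of the ghosts of the first `N` edges of `ξ`. -/
noncomputable def ghostIter (ξ : E.InfinitePath) : ℕ → PathModule E K → PathModule E K
  | 0, f => f
  | N + 1, f => ghostOp (ξ.edge N) (ghostIter ξ N f)

theorem ghostIter_mem (S : Submodule (WithIdentity (E.LeavittPathAlgebra K)) (PathModule E K))
    (ξ : E.InfinitePath) (N : ℕ) {f : PathModule E K} (hf : f ∈ S) : ghostIter ξ N f ∈ S := by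
  induction N with
  | zero => exact hf
  | succ N ih =>
    have := S.smul_mem (incl (LeavittPathAlgebra.ghost K (ξ.edge N))) ih
    rwa [incl_smul, rep_gen] at this

theorem ghostIter_apply_drop (ξ : E.InfinitePath) (N : ℕ) (f : PathModule E K) :
    ghostIter ξ N f (ξ.drop N) = T (-N) * f ξ := by
  induction N with
  | zero => simp [ghostIter, InfinitePath.drop_zero]
  | succ N ih =>
    have hr : E.r (ξ.edge N) = (ξ.drop (N + 1)).vertex 0 := by
      rw [ξ.range]
      exact congrArg ξ.vertex (by omega)
    have hc : InfinitePath.cons (ξ.edge N) (ξ.drop (N + 1)) hr = ξ.drop N :=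
      InfinitePath.ext_edge fun n => by
        cases n with
        | zero => exact congrArg ξ.edge (by omega)
        | succ n => exact congrArg ξ.edge (by omega)
    rw [ghostIter, ghostOp_apply, dif_pos hr, hc, ih, ← mul_assoc, ← T_add]
    congr 2
    push_cast
    ring

theorem exists_of_ghostIter_apply_ne_zero {ξ η : E.InfinitePath} {N : ℕ} {f : PathModule E K}
    (h : ghostIter ξ N f η ≠ 0) :
    ∃ ζ, f ζ ≠ 0 ∧ η = ζ.drop N ∧ ∀ i < N, ζ.edge i = ξ.edge i := by
  induction N generalizing η with
  | zero => exact ⟨η, h, rfl, fun i hi => absurd hi i.not_lt_zero⟩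
  | succ N ih =>
    rw [ghostIter, ghostOp_apply] at h
    split_ifs at h with hr
    · obtain ⟨ζ, hζ, hd, he⟩ := ih (right_ne_zero_of_mul h)
      refine ⟨ζ, hζ, ?_, fun i hi => ?_⟩
      · rw [← InfinitePath.drop_drop, ← hd, InfinitePath.drop_cons]
      · rcases Nat.lt_succ_iff_lt_or_eq.1 hi with hi | rfl
        · exact he i hi
        · have := congrFun (congrArg InfinitePath.edge hd) 0
          exact (congrArg ζ.edge (by omega)).trans this.symm
    · exact absurd rfl h

open Classical in
/-- The function supported at `ξ` with value `r`. -/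
noncomputable def single (ξ : E.InfinitePath) (r : K[T;T⁻¹]) : PathModule E K :=
  Pi.single ξ r

theorem single_apply_self (ξ : E.InfinitePath) (r : K[T;T⁻¹]) :
    (single ξ r : PathModule E K) ξ = r :=
  by classical exact Pi.single_eq_same _ _

theorem single_apply_of_ne {ξ η : E.InfinitePath} (h : η ≠ ξ) (r : K[T;T⁻¹]) :
    (single ξ r : PathModule E K) η = 0 :=
  by classical exact Pi.single_eq_of_ne h _

theorem eq_single {f : PathModule E K} {ξ : E.InfinitePath} (h : ∀ η, f η ≠ 0 → η = ξ) :
    f = single ξ (f ξ) := by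
  ext η : 1
  by_cases hη : η = ξ
  · rw [hη, single_apply_self]
  · rw [single_apply_of_ne hη]
    by_contra h0
    exact hη (h η h0)

/-- Only support paths sharing the first N edges of ξ survive the ghosts, so a long enough prefix
isolates ξ. -/
theorem ghostIter_eq_single {ξ : E.InfinitePath} {N : ℕ} {f : PathModule E K}
    (h : ∀ ζ, f ζ ≠ 0 → (∀ i < N, ζ.edge i = ξ.edge i) → ζ = ξ) :
    ghostIter ξ N f = single (ξ.drop N) (T (-N) * f ξ) := by
  rw [← ghostIter_apply_drop]
  refine eq_single fun η hη => ?_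
  obtain ⟨ζ, hζ, rfl, he⟩ := exists_of_ghostIter_apply_ne_zero hη
  rw [h ζ hζ he]

theorem ghostIter_single (ξ : E.InfinitePath) (N : ℕ) (r : K[T;T⁻¹]) :
    ghostIter ξ N (single ξ r : PathModule E K) = single (ξ.drop N) (T (-N) * r) := by
  rw [ghostIter_eq_single, single_apply_self]
  intro ζ hζ _
  by_contra hne
  exact hζ (single_apply_of_ne hne r)

theorem exists_forall_edge_eq {f : PathModule E K} (hf : {η | f η ≠ 0}.Finite)
    (ξ : E.InfinitePath) :
    ∃ N, ∀ ζ, f ζ ≠ 0 → (∀ i < N, ζ.edge i = ξ.edge i) → ζ = ξ := by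
  classical
  have hex : ∀ ζ : E.InfinitePath, ∃ i, ζ ≠ ξ → ζ.edge i ≠ ξ.edge i := by
    intro ζ
    by_cases h : ζ = ξ
    · exact ⟨0, fun h' => absurd h h'⟩
    · by_contra hcon
      push Not at hcon
      exact h (InfinitePath.ext_edge fun n => (hcon n).2)
  choose d hd using hex
  -- d ζ is an index where ζ differs from ξ; one more than the largest such index over the support
  -- separates them all.
  refine ⟨hf.toFinset.sup d + 1, fun ζ hζ he => ?_⟩
  by_contra hne
  refine hd ζ hne (he _ (Nat.lt_succ_of_le (Finset.le_sup (f := d) ?_)))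
  rwa [Set.Finite.mem_toFinset]

/-- The finitely supported functions on the paths that have `ξ` as a tail. -/
def tailSupported (K : Type uK) [Field K] (ξ : E.InfinitePath) :
    Submodule K[T;T⁻¹] (PathModule E K) where
  carrier := {f | {η | f η ≠ 0}.Finite ∧ ∀ η, f η ≠ 0 → ∃ k, η.drop k = ξ}
  zero_mem' := ⟨by simp [zero_apply], fun η h => absurd rfl h⟩
  add_mem' := by
    rintro f g ⟨hf, hf'⟩ ⟨hg, hg'⟩
    have key : ∀ η, (f + g) η ≠ 0 → f η ≠ 0 ∨ g η ≠ 0 := by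
      intro η h
      by_contra hcon
      push Not at hcon
      exact h (by rw [add_apply, hcon.1, hcon.2, add_zero])
    exact ⟨(hf.union hg).subset key, fun η h => (key η h).elim (hf' η) (hg' η)⟩
  smul_mem' := by
    rintro c f ⟨hf, hf'⟩
    exact ⟨hf.subset fun η h => right_ne_zero_of_mul h,
      fun η h => hf' η (right_ne_zero_of_mul h)⟩

/-- Prolonging by a fixed edge is injective and shortening sends finite sets to finite sets, so
supports stay finite. Periodicity keeps ξ a tail even after its own first edge is removed. -/
theorem genOp_mem_tailSupported {ξ : E.InfinitePath} {n : ℕ} (hn : 0 < n) (hξ : ξ.drop n = ξ)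
    (g : E.Generator) {f : PathModule E K} (hf : f ∈ tailSupported K ξ) :
    genOp g f ∈ tailSupported K ξ := by
  classical
  obtain ⟨hf, hf'⟩ := hf
  rcases g with v | e | e
  · have key : ∀ η, vertOp v f η ≠ 0 → f η ≠ 0 := by
      intro η h
      rw [vertOp_apply] at h
      split_ifs at h
      · exact h
      · exact absurd rfl h
    exact ⟨hf.subset key, fun η h => hf' η (key η h)⟩
  · have key : ∀ η, realOp e f η ≠ 0 → η.edge 0 = e ∧ f (η.drop 1) ≠ 0 := by
      intro η h
      rw [realOp_apply] at h
      split_ifs at h with h1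
      · exact ⟨h1, right_ne_zero_of_mul h⟩
      · exact absurd rfl h
    refine ⟨Set.Finite.of_finite_image (f := InfinitePath.drop 1) (hf.subset ?_) ?_, fun η h => ?_⟩
    · rintro _ ⟨η, h, rfl⟩
      exact (key η h).2
    · intro η h ζ h' hd
      exact InfinitePath.eq_of_drop_eq ((key η h).1.trans (key ζ h').1.symm) hd
    · obtain ⟨k, hk⟩ := hf' _ (key η h).2
      exact ⟨_, (InfinitePath.drop_drop 1 k η).symm.trans hk⟩
  · have key : ∀ η, ghostOp e f η ≠ 0 → ∃ ζ, f ζ ≠ 0 ∧ ζ.drop 1 = η := by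
      intro η h
      rw [ghostOp_apply] at h
      split_ifs at h with h1
      · exact ⟨_, right_ne_zero_of_mul h, InfinitePath.drop_cons h1⟩
      · exact absurd rfl h
    refine ⟨(hf.image (InfinitePath.drop 1)).subset key, fun η h => ?_⟩
    obtain ⟨ζ, hζ, rfl⟩ := key η h
    obtain ⟨k, hk⟩ := hf' ζ hζ
    -- The removed edge and n - 1 further ones make a full period.
    refine ⟨k + (n - 1), ?_⟩
    rw [InfinitePath.drop_drop, show 1 + (k + (n - 1)) = k + n by omega, ← InfinitePath.drop_drop,
      hk, hξ]

theorem smul_mem_tailSupported {ξ : E.InfinitePath} {n : ℕ} (hn : 0 < n) (hξ : ξ.drop n = ξ)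
    (w : WithIdentity (E.LeavittPathAlgebra K)) {f : PathModule E K}
    (hf : f ∈ tailSupported K ξ) : w • f ∈ tailSupported K ξ := by
  have key : ∀ (x : E.LeavittPathAlgebra K), ∀ f ∈ tailSupported K ξ,
      rep E K x f ∈ tailSupported K ξ := by
    intro x
    refine LeavittPathAlgebra.induction ?_ ?_ ?_ ?_ ?_ x
    · intro g f hf
      rw [rep_gen]
      exact genOp_mem_tailSupported hn hξ g hf
    · intro f _
      rw [map_zero]
      exact zero_mem _
    · intro x y hx hy f hf
      rw [map_add]
      exact add_mem (hx f hf) (hy f hf)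
    · intro x y hx hy f hf
      rw [map_mul]
      exact hx _ (hy f hf)
    · intro c x hx f hf
      rw [map_smul]
      exact (tailSupported K ξ).smul_of_tower_mem c (hx f hf)
  obtain ⟨m, x, rfl⟩ := exists_eq_intCast_add_incl w
  rw [add_smul, incl_smul, Int.cast_smul_eq_zsmul]
  exact add_mem (zsmul_mem hf m) (key x f hf)

theorem single_mem_tailSupported (ξ : E.InfinitePath) (r : K[T;T⁻¹]) :
    single ξ r ∈ tailSupported K ξ := by
  have key : ∀ η, (single ξ r : PathModule E K) η ≠ 0 → η = ξ := by
    intro η h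
    by_contra hne
    exact h (single_apply_of_ne hne r)
  exact ⟨(Set.finite_singleton ξ).subset key, fun η h => ⟨0, key η h⟩⟩

theorem T_neg_sub_one_ne_zero {n : ℕ} (hn : 0 < n) : (T (-n) - 1 : K[T;T⁻¹]) ≠ 0 := by
  intro h
  rw [sub_eq_zero, ← T_zero] at h
  have := (AddMonoidAlgebra.single_left_inj (one_ne_zero (α := K))).1 h
  omega

/-- The first factor vanishes at T = 1. -/
theorem T_neg_sub_one_mul_ne_one (n : ℕ) (p : K[T;T⁻¹]) : (T (-n) - 1) * p ≠ 1 := by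
  intro h
  have := congrArg (LaurentPolynomial.eval₂ (RingHom.id K) 1) h
  simp at this

/-- A periodic infinite path produces a unitary module without simple submodules. -/
theorem not_isSemiArtinianRing {ξ : E.InfinitePath} {n : ℕ} (hn : 0 < n) (hξ : ξ.drop n = ξ) :
    ¬ IsSemiArtinianRing (E.LeavittPathAlgebra K) := by
  intro hsemi
  let δ : PathModule E K := single ξ 1
  have hδξ : δ ξ = 1 := single_apply_self ξ 1
  have hδ0 : δ ≠ 0 := fun h => one_ne_zero (α := K[T;T⁻¹]) <| by
    rw [← hδξ, h, zero_apply]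
  let M := Submodule.span (WithIdentity (E.LeavittPathAlgebra K)) {δ}
  have hδM : δ ∈ M := Submodule.mem_span_singleton_self δ
  have hM : ∀ f ∈ M, ∃ w : WithIdentity (E.LeavittPathAlgebra K), w • δ = f :=
    fun f hf => Submodule.mem_span_singleton.1 hf
  have hMnt : Nontrivial M := ⟨⟨δ, hδM⟩, 0, fun h => hδ0 (congrArg Subtype.val h)⟩
  have hvδ : incl (LeavittPathAlgebra.vert K (ξ.vertex 0)) • δ = δ := by
    rw [incl_smul, rep_gen]
    ext η : 1
    change vertOp _ _ _ = _
    rw [vertOp_apply]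
    split_ifs with h
    · rfl
    · refine (single_apply_of_ne ?_ _).symm
      rintro rfl
      exact h rfl
  have hMun : IsUnitaryLeftModule (E.LeavittPathAlgebra K) M := by
    refine isUnitaryLeftModule_of_forall ?_
    rintro ⟨f, hf⟩
    obtain ⟨w, rfl⟩ := hM f hf
    -- The first vertex v of ξ fixes δ, so wδ = (wv)δ with wv in L.
    obtain ⟨x, hx⟩ : ∃ x, w * incl (LeavittPathAlgebra.vert K (ξ.vertex 0)) = incl x :=
      ⟨_, mul_incl w _⟩
    refine ⟨x, ⟨δ, hδM⟩, Subtype.ext ?_⟩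
    change w • δ = incl x • δ
    rw [← hx, mul_smul, hvδ]
  obtain ⟨S, hS, -⟩ := hsemi M hMnt hMun
  let S' := S.map M.subtype
  have hgen : ∀ y ∈ S', y ≠ 0 → ∀ z ∈ S',
      ∃ w : WithIdentity (E.LeavittPathAlgebra K), w • y = z := by
    rintro _ ⟨y, hy, rfl⟩ hy0 _ ⟨z, hz, rfl⟩
    have hy0' : (⟨y, hy⟩ : S) ≠ 0 := fun h => hy0 (congrArg (fun t : S => ((t : M) : PathModule E K)) h)
    obtain ⟨w, hw⟩ := IsSimpleModule.toSpanSingleton_surjective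
      (WithIdentity (E.LeavittPathAlgebra K)) hy0' ⟨z, hz⟩
    exact ⟨w, congrArg (fun t : S => ((t : M) : PathModule E K)) hw⟩
  have hSnt : Nontrivial S := IsSimpleModule.nontrivial (WithIdentity (E.LeavittPathAlgebra K)) S
  obtain ⟨u, hu⟩ := exists_ne (0 : S)
  let f : PathModule E K := ((u : M) : PathModule E K)
  have hf0 : f ≠ 0 := fun h => hu (Subtype.ext (Subtype.ext h))
  have hfS : f ∈ S' := ⟨u, u.2, rfl⟩
  have hft : f ∈ tailSupported K ξ := by
    obtain ⟨w, hw⟩ := hM f (u : M).2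
    rw [← hw]
    exact smul_mem_tailSupported hn hξ w (single_mem_tailSupported ξ 1)
  obtain ⟨η, hη⟩ : ∃ η, f η ≠ 0 := by
    by_contra h
    push Not at h
    exact hf0 (PathModule.ext h)
  obtain ⟨k, hk⟩ := hft.2 η hη
  obtain ⟨N, hN⟩ := exists_forall_edge_eq hft.1 η
  have hNle : N ≤ k + n * N := (Nat.le_mul_of_pos_left N hn).trans (Nat.le_add_left _ _)
  -- k edges bring η to ξ, a multiple of the period keeps it there, and the total length is at least
  -- N, so η is isolated from the rest of the support.
  have hz := ghostIter_mem S' η (k + n * N) hfS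
  rw [ghostIter_eq_single fun ζ hζ he => hN ζ hζ fun i hi => he i (hi.trans_le hNle),
    ← InfinitePath.drop_drop, hk, InfinitePath.drop_mul hξ] at hz
  set r : K[T;T⁻¹] := T (-((k + n * N : ℕ) : ℤ)) * f η
  have hr0 : r ≠ 0 := mul_ne_zero (isUnit_T _).ne_zero hη
  -- One more period of ghost edges multiplies rδ by T⁻ⁿ; the difference is (T⁻ⁿ - 1)rδ.
  have hy := S'.sub_mem (ghostIter_mem S' ξ n hz) hz
  have hsingle : ∀ c : K[T;T⁻¹], (single ξ c : PathModule E K) = c • δ := by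
    intro c
    ext η : 1
    rw [smul_apply]
    by_cases h : η = ξ
    · rw [h, single_apply_self, hδξ, mul_one]
    · rw [single_apply_of_ne h, show δ η = 0 from single_apply_of_ne h _, mul_zero]
  rw [ghostIter_single, hξ, hsingle, hsingle, ← sub_smul, ← sub_one_mul] at hy
  have hc0 : (T (-n) - 1) * r ≠ 0 := mul_ne_zero (T_neg_sub_one_ne_zero hn) hr0
  have hy0 : ((T (-n) - 1) * r) • δ ≠ 0 := fun h => hc0 <| by
    have := congrFun h ξ
    rwa [smul_apply, hδξ, mul_one] at this
  obtain ⟨w, hw⟩ := hgen _ hy hy0 _ hz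
  rw [smul_smul_comm, hsingle] at hw
  -- Evaluating at ξ and cancelling r exhibits (wδ)(ξ) as an inverse of T⁻ⁿ - 1.
  have hw' := congrFun hw ξ
  rw [smul_apply, smul_apply, hδξ, mul_one, mul_right_comm] at hw'
  exact T_neg_sub_one_mul_ne_one n _ (mul_right_cancel₀ hr0 (hw'.trans (one_mul r).symm))

end PathModule

/-! ### From closed paths to periodic infinite paths. -/

namespace LeavittPathAlgebra

variable {E K}

theorem IsPath.source_head {u w : E.vertex} {l : List E.edge} (h : IsPath E u l w)
    (hl : 0 < l.length) : E.s l[0] = u := by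
  cases l with
  | nil => simp at hl
  | cons e l => exact h.1

theorem IsPath.range_last {u w : E.vertex} {l : List E.edge} (h : IsPath E u l w) {i : ℕ}
    (hi : i < l.length) (hi' : i + 1 = l.length) : E.r l[i] = w := by
  induction l generalizing u i with
  | nil => simp at hi
  | cons e l ih =>
    cases i with
    | zero =>
      have hl : l = [] := List.length_eq_zero_iff.1 (by simpa using hi'.symm)
      subst hl
      exact h.2
    | succ i =>
      simp only [List.length_cons] at hi hi'
      exact ih h.2 (by omega) (by omega)

theorem IsPath.range_eq_source {u w : E.vertex} {l : List E.edge} (h : IsPath E u l w) {i : ℕ}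
    (hi : i + 1 < l.length) : E.r l[i] = E.s l[i + 1] := by
  induction l generalizing u i with
  | nil => simp at hi
  | cons e l ih =>
    simp only [List.length_cons] at hi
    cases i with
    | zero => exact (h.2.source_head (by omega)).symm
    | succ i => exact ih h.2 (by omega)

/-- The closed path is repeated forever, indices being read modulo its length; closedness is needed
only where the index wraps around. -/
theorem exists_periodic_of_isPath {v : E.vertex} {l : List E.edge} (h : IsPath E v l v)
    (hl : l ≠ []) : ∃ ξ : E.InfinitePath, ξ.drop l.length = ξ := by
  have hn : 0 < l.length := List.length_pos_iff.2 hl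
  have hlt : ∀ k, k % l.length < l.length := fun k => Nat.mod_lt k hn
  have hs : ∀ {i j : ℕ} (hi : i < l.length) (hj : j < l.length), i = j → l[i] = l[j] := by
    rintro i _ hi hj rfl
    rfl
  refine ⟨⟨fun k => E.s (l[k % l.length]'(hlt k)), fun k => l[k % l.length]'(hlt k),
    fun k => rfl, fun k => ?_⟩, InfinitePath.ext_edge fun k => ?_⟩
  · have hk := hlt k
    by_cases hlast : k % l.length + 1 = l.length
    · have h0 : (k + 1) % l.length = 0 := by
        rw [← Nat.mod_add_mod, hlast, Nat.mod_self]
      rw [h.range_last hk hlast, hs (hlt (k + 1)) hn h0, h.source_head hn]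
    · have h1 : k % l.length + 1 < l.length := by omega
      have h0 : (k + 1) % l.length = k % l.length + 1 := by
        rw [← Nat.mod_add_mod, Nat.mod_eq_of_lt h1]
      rw [h.range_eq_source h1, hs (hlt (k + 1)) h1 h0]
  · exact hs _ _ (Nat.add_mod_right k l.length)

/-- A graph whose Leavitt path algebra is semi-artinian has no closed paths. -/
theorem isAcyclic_of_isSemiArtinianRing (hsemi : IsSemiArtinianRing (E.LeavittPathAlgebra K)) :
    IsAcyclic E := by
  intro v l h
  by_contra hl
  obtain ⟨ξ, hξ⟩ := exists_periodic_of_isPath h hl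
  exact PathModule.not_isSemiArtinianRing (List.length_pos_iff.2 hl) hξ hsemi

end LeavittPathAlgebra

end DirectedGraph

/-! ### The main theorem. -/

theorem corollary4p2 (E : DirectedGraph.{uV, uE}) (K : Type uK) [Field K]
    (hsemi : IsSemiArtinianRing (E.LeavittPathAlgebra K))
    (hfin : Finite (TwoSidedIdeal (E.LeavittPathAlgebra K))) :
    Finite (SimpleModuleClasses (E.LeavittPathAlgebra K)) ∧
    (∃ (n : ℕ) (S : Fin (n + 1) → TwoSidedIdeal (E.LeavittPathAlgebra K)),
      IsMaximalIdealChain S) ∧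
    ∀ (n : ℕ) (S : Fin (n + 1) → TwoSidedIdeal (E.LeavittPathAlgebra K)),
      IsMaximalIdealChain S →
        (∀ i : Fin n,
          IsSimpleNonUnitalRing (TwoSidedIdeal.FactorRing (S i.castSucc) (S i.succ))) ∧
        Nat.card (SimpleModuleClasses (E.LeavittPathAlgebra K)) = n := by
  have hE := DirectedGraph.LeavittPathAlgebra.isAcyclic_of_isSemiArtinianRing hsemi
  have hu := DirectedGraph.LeavittPathAlgebra.exists_local_unit (E := E) (K := K)
  have hsq : ∀ I J : TwoSidedIdeal (E.LeavittPathAlgebra K), I < J →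
      ∃ a ∈ J, ∃ b ∈ J, a * b ∉ I := by
    intro I J hIJ
    obtain ⟨ε, hεJ, hεI, hε⟩ :=
      DirectedGraph.LeavittPathAlgebra.exists_idempotent_of_lt hE hIJ
    -- ε = ε * ε is itself a product of two elements of J outside I.
    exact ⟨ε, hεJ, ε, hεJ, hε.symm ▸ hεI⟩
  obtain ⟨n, S, hS⟩ := exists_isMaximalIdealChain (R := E.LeavittPathAlgebra K)
  obtain ⟨f⟩ := hS.nonempty_equiv hsemi hu hsq
  refine ⟨Finite.of_equiv _ f.symm, ⟨n, S, hS⟩, fun m T hT => ⟨fun i => ?_, ?_⟩⟩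
  · exact TwoSidedIdeal.isSimple_factorRing hu (hT.step i) (hsq _ _ (hT.step i).lt)
  · obtain ⟨g⟩ := hT.nonempty_equiv hsemi hu hsq
    rw [Nat.card_congr g, Nat.card_fin]
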